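/- Consider first-order logic over an arbitrary language, with logical symbols $\perp,\wedge,\vee,\to,\forall,\exists$, where $\neg\varphi$ abbreviates $\varphi\to\perp$ and formulas are taken up to renaming of bound variables. Classical derivations are tree derivations in Gentzen's sequent calculus $\mathbf{LK}$ with cut: sequents $\Gamma\Rightarrow\Delta$ consist of finite sequences of formulas, the structural rules are weakening, contraction and exchange on both sides, the logical rules are the usual left and right rules for $\wedge,\vee,\to,\forall,\exists$ (with the eigenvariable condition for $\forall$:right and $\exists$:left), and the initial sequents are $\varphi\Rightarrow\varphi$ and $\Gamma,\perp\,\Rightarrow\Delta$. A theory $T$ is a set of sentences; in derivations from $T$ all sequents $\Gamma\Rightarrow\psi$ with $\psi\in T$ are additional initial sequents. A derivation is intuitionistic if the succedent of each of its sequents contains at most one formula. $T\vdash_c\varphi$ (respectively $T\vdash_i\varphi$) means that the sequent $\emptyset\Rightarrow\varphi$ has a classical (respectively an intuitionistic) derivation from $T$. The size $|\mathcal D|$ of a derivation $\mathcal D$ is the total number of symbols of the sequents occurring in it, each occurrence of a variable, function symbol or relation symbol counting as one symbol. Positive formulas are built from atomic formulas and $\perp$ by $\wedge$, $\vee$ and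 $\exists$. Geometric implications are the positive formulas, the implications $\psi\to\theta$ between positive formulas, and the results of prefixing universal quantifiers to positive formulas and to implications of positive formulas. A theory is geometric if all its axioms are geometric implications. Theorem. If $T$ is a geometric theory and $\varphi$ is a geometric implication, then $$T\vdash_c\varphi\quad\text{implies}\quad T\vdash_i\varphi .$$ Moreover, there is a polynomial $p$ with coefficients in $\mathbb N$, independent of the language, of $T$ and of $\varphi$, such that whenever $\mathcal D$ is a classical derivation of $\emptyset\Rightarrow\varphi$ from a geometric theory $T$, with $\varphi$ a geometric implication, there is an intuitionistic derivation $\mathcal D'$ of $\emptyset\Rightarrow\varphi$ from $T$ with $|\mathcal D'|\le p(|\mathcal D|)$. -/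

import Mathlib

universe u v

namespace SequentCalculus

/-- Formulas of first-order logic over the language `L`, with the primitive logical symbols
`⊥, ∧, ∨, →, ∀, ∃` (none is definable from the others intuitionistically). Terms are Mathlib's
first-order terms with variables `0, 1, 2, …`. Binding is in de Bruijn style, so formulas are taken
up to renaming of bound variables: in `all φ` and `ex φ` the variable `0` of `φ` is bound, and the
variable `n + 1` of `φ` denotes the variable `n` outside of the quantifier. Equality, where it is
wanted, is one of the relation symbols of `L`. -/
inductive Formula (L : FirstOrder.Language.{u, v}) : Type (max u v)
  | falsum : Formula L
  | rel {k : ℕ} (R : L.Relations k) (ts : Fin k → L.Term ℕ) : Formula L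
  | and (φ ψ : Formula L) : Formula L
  | or (φ ψ : Formula L) : Formula L
  | imp (φ ψ : Formula L) : Formula L
  | all (φ : Formula L) : Formula L
  | ex (φ : Formula L) : Formula L

/-- The number of symbols of a term. -/
def termSize {L : FirstOrder.Language.{u, v}} : L.Term ℕ → ℕ
  | .var _ => 1
  | .func _ ts => 1 + ∑ i, termSize (ts i)

/-- A substitution of terms for variables, pushed below a quantifier. -/
def liftSubst {L : FirstOrder.Language.{u, v}} (σ : ℕ → L.Term ℕ) : ℕ → L.Term ℕ
  | 0 => .var 0
  | n + 1 => (σ n).relabel Nat.succ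

namespace Formula

variable {L : FirstOrder.Language.{u, v}}

/-- The number of symbols of a formula; a quantifier counts together with its bound variable. -/
def size : Formula L → ℕ
  | falsum => 1
  | rel _ ts => 1 + ∑ i, termSize (ts i)
  | and φ ψ => 1 + φ.size + ψ.size
  | or φ ψ => 1 + φ.size + ψ.size
  | imp φ ψ => 1 + φ.size + ψ.size
  | all φ => 2 + φ.size
  | ex φ => 2 + φ.size

/-- The set of the variables that occur free in a formula. -/
def freeVars : Formula L → Set ℕ
  | falsum => ∅
  | rel _ ts => {n | ∃ i, n ∈ (ts i).varFinset}
  | and φ ψ => φ.freeVars ∪ ψ.freeVars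
  | or φ ψ => φ.freeVars ∪ ψ.freeVars
  | imp φ ψ => φ.freeVars ∪ ψ.freeVars
  | all φ => {n | n + 1 ∈ φ.freeVars}
  | ex φ => {n | n + 1 ∈ φ.freeVars}

/-- Simultaneous (capture-avoiding) substitution of terms for the free variables. -/
def subst : Formula L → (ℕ → L.Term ℕ) → Formula L
  | falsum, _ => falsum
  | rel R ts, σ => rel R fun i => (ts i).subst σ
  | and φ ψ, σ => and (φ.subst σ) (ψ.subst σ)
  | or φ ψ, σ => or (φ.subst σ) (ψ.subst σ)
  | imp φ ψ, σ => imp (φ.subst σ) (ψ.subst σ)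
  | all φ, σ => all (φ.subst (liftSubst σ))
  | ex φ, σ => ex (φ.subst (liftSubst σ))

/-- For the body `φ` of a quantified formula `all φ` or `ex φ`, that is, of `∀ x, φ(x)` or
`∃ x, φ(x)`, the instance `φ(t)`. -/
def inst (φ : Formula L) (t : L.Term ℕ) : Formula L :=
  φ.subst fun n => Nat.casesOn n t .var

/-- Positive formulas: built from atomic formulas and `⊥` by `∧`, `∨` and `∃`. -/
inductive IsPositive : Formula L → Prop
  | falsum : IsPositive falsum
  | rel {k : ℕ} (R : L.Relations k) (ts : Fin k → L.Term ℕ) : IsPositive (rel R ts)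
  | and {φ ψ : Formula L} : IsPositive φ → IsPositive ψ → IsPositive (and φ ψ)
  | or {φ ψ : Formula L} : IsPositive φ → IsPositive ψ → IsPositive (or φ ψ)
  | ex {φ : Formula L} : IsPositive φ → IsPositive (ex φ)

/-- Geometric implications: positive formulas, implications between positive formulas, and the
results of prefixing universal quantifiers to such formulas. -/
inductive IsGeometricImplication : Formula L → Prop
  | positive {φ : Formula L} : IsPositive φ → IsGeometricImplication φ
  | imp {φ ψ : Formula L} : IsPositive φ → IsPositive ψ → IsGeometricImplication (imp φ ψ)
  | all {φ : Formula L} : IsGeometricImplication φ → IsGeometricImplication (all φ)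

end Formula

/-- A theory is a set of sentences, i.e. of formulas without free variables. -/
abbrev Theory (L : FirstOrder.Language.{u, v}) : Type (max u v) :=
  Set {φ : Formula L // φ.freeVars = ∅}

/-- A theory is geometric if all its axioms are geometric implications. -/
def Theory.IsGeometric {L : FirstOrder.Language.{u, v}} (T : Theory L) : Prop :=
  ∀ ψ ∈ T, ψ.val.IsGeometricImplication

/-- A sequent `Γ ⇒ Δ`: `ante` is the antecedent `Γ`, `succ` is the succedent `Δ`. -/
structure Sequent (L : FirstOrder.Language.{u, v}) : Type (max u v) where
  ante : List (Formula L)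
  succ : List (Formula L)

namespace Sequent

variable {L : FirstOrder.Language.{u, v}}

/-- The number of symbols of a sequent (the arrow counts as one symbol). -/
def size (s : Sequent L) : ℕ :=
  1 + (s.ante.map Formula.size).sum + (s.succ.map Formula.size).sum

/-- The variables that occur free in a sequent. -/
def freeVars (s : Sequent L) : Set ℕ :=
  {a | ∃ φ ∈ s.ante ++ s.succ, a ∈ φ.freeVars}

/-- A sequent is intuitionistic if its succedent contains at most one formula. -/
def IsIntuitionistic (s : Sequent L) : Prop :=
  s.succ.length ≤ 1

end Sequent

/-- Derivations (trees, with cut) in Gentzen's classical sequent calculus `LK`, with a constant `⊥`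
in place of negation, from the axioms of the theory `T`. The side condition of `allRight` and
`exLeft` is the eigenvariable condition: the variable `a` does not occur free in the lower
sequent. -/
inductive Derivation {L : FirstOrder.Language.{u, v}} (T : Theory L) : Sequent L → Type (max u v)
  /- initial sequents -/
  | init (φ : Formula L) : Derivation T ⟨[φ], [φ]⟩
  | bot (Γ Δ : List (Formula L)) : Derivation T ⟨Γ ++ [.falsum], Δ⟩
  | ax (Γ : List (Formula L)) (φ : {φ : Formula L // φ.freeVars = ∅}) (h : φ ∈ T) :
      Derivation T ⟨Γ, [φ.val]⟩
  /- structural rules -/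
  | weakLeft {Γ Δ : List (Formula L)} (φ : Formula L) :
      Derivation T ⟨Γ, Δ⟩ → Derivation T ⟨φ :: Γ, Δ⟩
  | weakRight {Γ Δ : List (Formula L)} (φ : Formula L) :
      Derivation T ⟨Γ, Δ⟩ → Derivation T ⟨Γ, Δ ++ [φ]⟩
  | contrLeft {Γ Δ : List (Formula L)} {φ : Formula L} :
      Derivation T ⟨φ :: φ :: Γ, Δ⟩ → Derivation T ⟨φ :: Γ, Δ⟩
  | contrRight {Γ Δ : List (Formula L)} {φ : Formula L} :
      Derivation T ⟨Γ, Δ ++ [φ, φ]⟩ → Derivation T ⟨Γ, Δ ++ [φ]⟩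
  | exchLeft {Γ Γ' Δ : List (Formula L)} {φ ψ : Formula L} :
      Derivation T ⟨Γ ++ φ :: ψ :: Γ', Δ⟩ → Derivation T ⟨Γ ++ ψ :: φ :: Γ', Δ⟩
  | exchRight {Γ Δ Δ' : List (Formula L)} {φ ψ : Formula L} :
      Derivation T ⟨Γ, Δ ++ φ :: ψ :: Δ'⟩ → Derivation T ⟨Γ, Δ ++ ψ :: φ :: Δ'⟩
  | cut {Γ Γ' Δ Δ' : List (Formula L)} {φ : Formula L} :
      Derivation T ⟨Γ, Δ ++ [φ]⟩ → Derivation T ⟨φ :: Γ', Δ'⟩ → Derivation T ⟨Γ ++ Γ', Δ ++ Δ'⟩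
  /- logical rules -/
  | andLeft₁ {Γ Δ : List (Formula L)} {φ : Formula L} (ψ : Formula L) :
      Derivation T ⟨φ :: Γ, Δ⟩ → Derivation T ⟨.and φ ψ :: Γ, Δ⟩
  | andLeft₂ {Γ Δ : List (Formula L)} (φ : Formula L) {ψ : Formula L} :
      Derivation T ⟨ψ :: Γ, Δ⟩ → Derivation T ⟨.and φ ψ :: Γ, Δ⟩
  | andRight {Γ Δ : List (Formula L)} {φ ψ : Formula L} :
      Derivation T ⟨Γ, Δ ++ [φ]⟩ → Derivation T ⟨Γ, Δ ++ [ψ]⟩ →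
      Derivation T ⟨Γ, Δ ++ [.and φ ψ]⟩
  | orLeft {Γ Δ : List (Formula L)} {φ ψ : Formula L} :
      Derivation T ⟨φ :: Γ, Δ⟩ → Derivation T ⟨ψ :: Γ, Δ⟩ → Derivation T ⟨.or φ ψ :: Γ, Δ⟩
  | orRight₁ {Γ Δ : List (Formula L)} {φ : Formula L} (ψ : Formula L) :
      Derivation T ⟨Γ, Δ ++ [φ]⟩ → Derivation T ⟨Γ, Δ ++ [.or φ ψ]⟩
  | orRight₂ {Γ Δ : List (Formula L)} (φ : Formula L) {ψ : Formula L} :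
      Derivation T ⟨Γ, Δ ++ [ψ]⟩ → Derivation T ⟨Γ, Δ ++ [.or φ ψ]⟩
  | impLeft {Γ Γ' Δ Δ' : List (Formula L)} {φ ψ : Formula L} :
      Derivation T ⟨Γ, Δ ++ [φ]⟩ → Derivation T ⟨ψ :: Γ', Δ'⟩ →
      Derivation T ⟨.imp φ ψ :: (Γ ++ Γ'), Δ ++ Δ'⟩
  | impRight {Γ Δ : List (Formula L)} {φ ψ : Formula L} :
      Derivation T ⟨φ :: Γ, Δ ++ [ψ]⟩ → Derivation T ⟨Γ, Δ ++ [.imp φ ψ]⟩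
  | allLeft {Γ Δ : List (Formula L)} {φ : Formula L} (t : L.Term ℕ) :
      Derivation T ⟨φ.inst t :: Γ, Δ⟩ → Derivation T ⟨.all φ :: Γ, Δ⟩
  | allRight {Γ Δ : List (Formula L)} {φ : Formula L} (a : ℕ)
      (ha : a ∉ Sequent.freeVars ⟨Γ, Δ ++ [.all φ]⟩) :
      Derivation T ⟨Γ, Δ ++ [φ.inst (.var a)]⟩ → Derivation T ⟨Γ, Δ ++ [.all φ]⟩
  | exLeft {Γ Δ : List (Formula L)} {φ : Formula L} (a : ℕ)
      (ha : a ∉ Sequent.freeVars ⟨.ex φ :: Γ, Δ⟩) :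
      Derivation T ⟨φ.inst (.var a) :: Γ, Δ⟩ → Derivation T ⟨.ex φ :: Γ, Δ⟩
  | exRight {Γ Δ : List (Formula L)} {φ : Formula L} (t : L.Term ℕ) :
      Derivation T ⟨Γ, Δ ++ [φ.inst t]⟩ → Derivation T ⟨Γ, Δ ++ [.ex φ]⟩

namespace Derivation

variable {L : FirstOrder.Language.{u, v}} {T : Theory L}

/-- All sequents of a derivation, one for each node of the tree. -/
def sequents {s : Sequent L} (d : Derivation T s) : List (Sequent L) :=
  s :: match d with
  | init _ => []
  | bot _ _ => []
  | ax _ _ _ => []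
  | weakLeft _ d => d.sequents
  | weakRight _ d => d.sequents
  | contrLeft d => d.sequents
  | contrRight d => d.sequents
  | exchLeft d => d.sequents
  | exchRight d => d.sequents
  | cut d e => d.sequents ++ e.sequents
  | andLeft₁ _ d => d.sequents
  | andLeft₂ _ d => d.sequents
  | andRight d e => d.sequents ++ e.sequents
  | orLeft d e => d.sequents ++ e.sequents
  | orRight₁ _ d => d.sequents
  | orRight₂ _ d => d.sequents
  | impLeft d e => d.sequents ++ e.sequents
  | impRight d => d.sequents
  | allLeft _ d => d.sequents
  | allRight _ _ d => d.sequents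
  | exLeft _ _ d => d.sequents
  | exRight _ d => d.sequents

/-- The size of a derivation: the total number of symbols of its sequents. -/
def size {s : Sequent L} (d : Derivation T s) : ℕ :=
  (d.sequents.map Sequent.size).sum

/-- A derivation is intuitionistic if all its sequents are intuitionistic. -/
def IsIntuitionistic {s : Sequent L} (d : Derivation T s) : Prop :=
  ∀ s' ∈ d.sequents, s'.IsIntuitionistic

end Derivation

/-- `T ⊢_c φ`: the sequent `⇒ φ` has a classical derivation from `T`. -/
def ProvesClassically {L : FirstOrder.Language.{u, v}} (T : Theory L) (φ : Formula L) : Prop :=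
  Nonempty (Derivation T ⟨[], [φ]⟩)

/-- `T ⊢_i φ`: the sequent `⇒ φ` has an intuitionistic derivation from `T`. -/
def ProvesIntuitionistically {L : FirstOrder.Language.{u, v}} (T : Theory L) (φ : Formula L) : Prop :=
  ∃ d : Derivation T ⟨[], [φ]⟩, d.IsIntuitionistic

end SequentCalculus

/-! The proof combines Kuroda's negative translation with Friedman's trick of replacing `⊥` by a
formula `R` inside negations. Write `¬X` for `X → R`. The translation `kuroda R` puts `¬¬` below
every `→` and `∀` and leaves the rest alone. In particular `⊥` stays `⊥`, which is harmless because
`⊥ ⇒ R` is initial. Three facts carry the argument.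

Simulation (`Derivation.prv_translate`): a classical derivation of `Γ ⇒ Δ` becomes, rule by rule, an
intuitionistic derivation of `R` from the translations of `Γ` and the negated translations of `Δ`.
Right rules for `→` and `∀` go through thanks to the inserted `¬¬`; on the left these `¬¬` cost
nothing, since the goal is always `R`.

Axioms (`Prv.kuroda_of_isGeometricImplication`): positive formulas contain neither `→` nor `∀`, so
they are their own translations. Hence a geometric implication intuitionistically implies its
translation.

Choice of `R` (`Formula.IsGeometricImplication.exists_sequent`): for the goal `∀ x, (α → β)`, strip
the quantifiers with suitable variables `a` and take `R = β(a)`. The translated goal together with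
`α(a)` yields `R`; by simulation so does its negation. A cut gives `α(a) ⇒ β(a)`, from which the
goal follows.

For the size, the translation multiplies a formula by a factor linear in `|R|`, and each classical
inference costs a bounded number of intuitionistic ones, up to rearranging antecedents. So it
suffices to bound separately the number of sequents and the size of each. -/

namespace SequentCalculus

/-! ### Substitution, renaming and instances. -/

variable {L : FirstOrder.Language.{u, v}}

open FirstOrder.Language Formula

theorem term_subst_subst (t : L.Term ℕ) (σ τ : ℕ → L.Term ℕ) :
    (t.subst σ).subst τ = t.subst fun n => (σ n).subst τ := by
  induction t with
  | var a => rfl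
  | func f ts ih => simp only [Term.subst, ih]

theorem term_subst_var (t : L.Term ℕ) : t.subst .var = t := by
  induction t with
  | var a => rfl
  | func f ts ih => simp only [Term.subst, ih]

theorem term_relabel_eq_subst (t : L.Term ℕ) (f : ℕ → ℕ) :
    t.relabel f = t.subst fun n => .var (f n) := by
  induction t with
  | var a => rfl
  | func f ts ih => simp only [Term.subst, Term.relabel, ih]

theorem term_subst_congr (t : L.Term ℕ) {σ τ : ℕ → L.Term ℕ}
    (h : ∀ n ∈ t.varFinset, σ n = τ n) : t.subst σ = t.subst τ := by
  induction t with
  | var a => exact h a (by simp [Term.varFinset])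
  | func f ts ih =>
    simp only [Term.subst, Term.func.injEq, heq_eq_eq, true_and]
    funext i
    exact ih i fun n hn => h n (by simp only [Term.varFinset, Finset.mem_biUnion]; exact
      ⟨i, by simp, hn⟩)

theorem termSize_subst_var (t : L.Term ℕ) (ρ : ℕ → ℕ) :
    termSize (t.subst fun n => .var (ρ n)) = termSize t := by
  induction t with
  | var a => rfl
  | func f ts ih => simp only [Term.subst, termSize, ih]

theorem liftSubst_var : liftSubst (L := L) .var = .var := by
  funext n; cases n <;> rfl

theorem liftSubst_comp (σ τ : ℕ → L.Term ℕ) :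
    (fun n => (liftSubst σ n).subst (liftSubst τ)) = liftSubst fun n => (σ n).subst τ := by
  funext n
  cases n with
  | zero => rfl
  | succ n => simp only [liftSubst, term_relabel_eq_subst, term_subst_subst, Term.subst]

theorem liftSubst_rename (ρ : ℕ → ℕ) :
    liftSubst (L := L) (fun n => .var (ρ n)) =
      fun n => .var (Nat.casesOn n 0 fun m => ρ m + 1 : ℕ) := by
  funext n; cases n <;> rfl

namespace Formula

theorem subst_subst (φ : Formula L) (σ τ : ℕ → L.Term ℕ) :
    (φ.subst σ).subst τ = φ.subst fun n => (σ n).subst τ := by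
  induction φ generalizing σ τ with
  | falsum => rfl
  | rel R ts => simp only [subst, term_subst_subst]
  | and φ ψ h₁ h₂ | or φ ψ h₁ h₂ | imp φ ψ h₁ h₂ => simp only [subst, h₁, h₂]
  | all φ h | ex φ h => simp only [subst, h, liftSubst_comp]

theorem subst_var (φ : Formula L) : φ.subst .var = φ := by
  induction φ with
  | falsum => rfl
  | rel R ts => simp only [subst, term_subst_var]
  | and φ ψ h₁ h₂ | or φ ψ h₁ h₂ | imp φ ψ h₁ h₂ => simp only [subst, h₁, h₂]
  | all φ h | ex φ h => simp only [subst, liftSubst_var, h]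

theorem subst_congr (φ : Formula L) {σ τ : ℕ → L.Term ℕ}
    (h : ∀ n ∈ φ.freeVars, σ n = τ n) : φ.subst σ = φ.subst τ := by
  induction φ generalizing σ τ with
  | falsum => rfl
  | rel R ts =>
    simp only [subst, rel.injEq, heq_eq_eq, true_and]
    funext i
    exact term_subst_congr _ fun n hn => h n ⟨i, hn⟩
  | and φ ψ h₁ h₂ | or φ ψ h₁ h₂ | imp φ ψ h₁ h₂ =>
    simp only [subst]
    rw [h₁ fun n hn => h n (Or.inl hn), h₂ fun n hn => h n (Or.inr hn)]
  | all φ ih | ex φ ih =>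
    simp only [subst]
    rw [ih]
    intro n hn
    cases n with
    | zero => rfl
    | succ n => simp only [liftSubst, h n hn]

theorem subst_eq_self {φ : Formula L} (h : φ.freeVars = ∅) (σ : ℕ → L.Term ℕ) :
    φ.subst σ = φ := by
  conv_rhs => rw [← subst_var φ]
  exact subst_congr φ (by simp [h])

theorem size_rename (φ : Formula L) (ρ : ℕ → ℕ) :
    (φ.subst fun n => .var (ρ n)).size = φ.size := by
  induction φ generalizing ρ with
  | falsum => rfl
  | rel R ts => simp only [subst, size, termSize_subst_var]
  | and φ ψ h₁ h₂ | or φ ψ h₁ h₂ | imp φ ψ h₁ h₂ => simp only [subst, size, h₁, h₂]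
  | all φ h | ex φ h => simp only [subst, size, liftSubst_rename, h]

theorem inst_var (φ : Formula L) (a : ℕ) :
    φ.inst (.var a) = φ.subst fun n => .var (Nat.casesOn n a id : ℕ) := by
  unfold inst
  congr 1
  funext n
  cases n <;> rfl

theorem size_inst_var (φ : Formula L) (a : ℕ) : (φ.inst (.var a)).size = φ.size := by
  rw [inst_var, size_rename]

theorem size_pos (φ : Formula L) : 1 ≤ φ.size := by
  cases φ <;> simp only [size] <;> omega

theorem subst_inst (φ : Formula L) (t : L.Term ℕ) (σ : ℕ → L.Term ℕ) :
    (φ.inst t).subst σ = (φ.subst (liftSubst σ)).inst (t.subst σ) := by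
  simp only [inst, subst_subst]
  congr 1
  funext n
  cases n with
  | zero => rfl
  | succ n => simp [liftSubst, term_relabel_eq_subst, term_subst_subst, Term.subst, term_subst_var]

/-- Renaming an eigenvariable `a` to `b`. -/
theorem subst_update_inst (φ : Formula L) {a : ℕ} (ha : a + 1 ∉ φ.freeVars) (b : ℕ) (ρ : ℕ → ℕ) :
    (φ.inst (.var a)).subst (fun n => .var (Function.update ρ a b n)) =
      (φ.subst (liftSubst fun n => .var (ρ n))).inst (.var b) := by
  rw [subst_inst]
  simp only [Term.subst, Function.update_self]
  congr 1
  apply subst_congr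
  intro n hn
  cases n with
  | zero => rfl
  | succ n =>
    have : n ≠ a := by rintro rfl; exact ha hn
    simp [liftSubst, Function.update_of_ne this]

theorem finite_freeVars (φ : Formula L) : φ.freeVars.Finite := by
  induction φ with
  | falsum => exact Set.finite_empty
  | rel R ts =>
    have : (rel R ts).freeVars = ⋃ i, ((ts i).varFinset : Set ℕ) := by
      ext; simp [freeVars]
    rw [this]
    exact Set.finite_iUnion fun i => Finset.finite_toSet _
  | and φ ψ h₁ h₂ | or φ ψ h₁ h₂ | imp φ ψ h₁ h₂ => exact h₁.union h₂
  | all φ h | ex φ h => exact h.preimage (Nat.succ_injective.injOn)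

/-! ### Closure and induction for geometric implications. -/

theorem IsPositive.subst {φ : Formula L} (h : φ.IsPositive) (σ : ℕ → L.Term ℕ) :
    (φ.subst σ).IsPositive := by
  induction h generalizing σ with
  | falsum => exact .falsum
  | rel R ts => exact .rel R _
  | and _ _ h₁ h₂ => exact .and (h₁ σ) (h₂ σ)
  | or _ _ h₁ h₂ => exact .or (h₁ σ) (h₂ σ)
  | ex _ h => exact .ex (h _)

theorem IsGeometricImplication.subst {φ : Formula L} (h : φ.IsGeometricImplication)
    (σ : ℕ → L.Term ℕ) : (φ.subst σ).IsGeometricImplication := by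
  induction h generalizing σ with
  | positive h => exact .positive (h.subst σ)
  | imp h₁ h₂ => exact .imp (h₁.subst σ) (h₂.subst σ)
  | all _ h => exact .all (h _)

/-- Induction on geometric implications, where the hypothesis for `∀ x, φ(x)` speaks of the
instances `φ(a)`. -/
theorem IsGeometricImplication.induction_inst
    {P : (φ : Formula L) → φ.IsGeometricImplication → Prop}
    (positive : ∀ (φ : Formula L) (h : φ.IsPositive), P φ (.positive h))
    (imp : ∀ (φ ψ : Formula L) (h₁ : φ.IsPositive) (h₂ : ψ.IsPositive), P (φ.imp ψ) (.imp h₁ h₂))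
    (all : ∀ (φ : Formula L) (h : φ.IsGeometricImplication),
      (∀ a, P (φ.inst (.var a)) (h.subst _)) → P φ.all (.all h))
    {φ : Formula L} (h : φ.IsGeometricImplication) : P φ h := by
  -- An instance of the body is not a subformula, but it is a renaming of one; so the structural
  -- induction is carried out for all renamings at once.
  suffices ∀ (ψ : Formula L) (hψ : ψ.IsGeometricImplication) (ρ : ℕ → ℕ),
      (ψ = φ.subst fun n => .var (ρ n)) → P ψ hψ from
    this φ h id (subst_var φ).symm
  induction h with
  | positive h => rintro _ - ρ rfl; exact positive _ (h.subst _)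
  | imp h₁ h₂ => rintro _ - ρ rfl; exact imp _ _ (h₁.subst _) (h₂.subst _)
  | all h ih =>
    rintro _ - ρ rfl
    refine all _ (h.subst _) fun a => ?_
    -- The composite renaming: the bound variable `0` goes to `a`, and `m + 1` goes to `ρ m`.
    refine ih _ _ (fun n => Nat.casesOn (Nat.casesOn n 0 fun m => ρ m + 1 : ℕ) a id : ℕ → ℕ) ?_
    rw [inst_var, subst_subst, liftSubst_rename]
    rfl

/-! ### The Kuroda translation relative to `R`. -/

/-- The negation of `φ` relative to `R`. -/
def neg (R φ : Formula L) : Formula L := φ.imp R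

/-- `R` below a quantifier. -/
def shift (R : Formula L) : Formula L := R.subst fun n => .var (n + 1)

/-- The Kuroda translation relative to `R`: double negations are inserted below `→` and `∀`. -/
def kuroda : Formula L → Formula L → Formula L
  | _, falsum => falsum
  | _, rel S ts => rel S ts
  | R, and φ ψ => and (kuroda R φ) (kuroda R ψ)
  | R, or φ ψ => or (kuroda R φ) (kuroda R ψ)
  | R, imp φ ψ => imp (kuroda R φ) (neg R (neg R (kuroda R ψ)))
  | R, all φ => all (neg R.shift (neg R.shift (kuroda R.shift φ)))
  | R, ex φ => ex (kuroda R.shift φ)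

theorem size_shift (R : Formula L) : R.shift.size = R.size := size_rename R _

theorem shift_subst (R : Formula L) (σ : ℕ → L.Term ℕ) :
    R.shift.subst (liftSubst σ) = (R.subst σ).shift := by
  simp only [shift, subst_subst, Term.subst, liftSubst, term_relabel_eq_subst]

theorem shift_inst (R : Formula L) (t : L.Term ℕ) : R.shift.inst t = R := by
  simp only [inst, shift, subst_subst, Term.subst]
  exact subst_var R

theorem neg_neg_inst (R φ : Formula L) (t : L.Term ℕ) :
    (neg R.shift (neg R.shift φ)).inst t = neg R (neg R (φ.inst t)) := by
  change imp (imp (φ.inst t) (R.shift.inst t)) (R.shift.inst t) = _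
  rw [shift_inst]
  rfl

/-- The substitution must act on `R` as well, because `R` may have free variables and occurs inside
the translation. -/
theorem kuroda_subst (R φ : Formula L) (σ : ℕ → L.Term ℕ) :
    (kuroda R φ).subst σ = kuroda (R.subst σ) (φ.subst σ) := by
  induction φ generalizing R σ with
  | falsum | rel => rfl
  | and φ ψ h₁ h₂ | or φ ψ h₁ h₂ | imp φ ψ h₁ h₂ => simp only [kuroda, neg, subst, h₁, h₂]
  | all φ h | ex φ h => simp only [kuroda, neg, subst, h, shift_subst]

theorem kuroda_inst (R φ : Formula L) (t : L.Term ℕ) :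
    (kuroda R.shift φ).inst t = kuroda R (φ.inst t) := by
  unfold inst
  rw [kuroda_subst]
  congr 1
  exact shift_inst R t

/-- The translation changes a formula only at `→` and `∀`, and `⊥` is not replaced by `R`. This is
where geometric formulas are special. -/
theorem IsPositive.kuroda_eq {φ : Formula L} (h : φ.IsPositive) (R : Formula L) :
  kuroda R φ = φ := by
  induction h generalizing R with
  | falsum | rel => rfl
  | and _ _ h₁ h₂ | or _ _ h₁ h₂ => simp only [kuroda, h₁, h₂]
  | ex _ h => simp only [kuroda, h]

/-- Each `→` or `∀` adds two copies of `R` and two implication signs. -/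
theorem size_kuroda_le (R φ : Formula L) : (kuroda R φ).size ≤ (2 * R.size + 3) * φ.size := by
  induction φ generalizing R with
  | falsum | rel => simp only [kuroda]; nlinarith
  | and φ ψ h₁ h₂ | or φ ψ h₁ h₂ | imp φ ψ h₁ h₂ =>
    have := h₁ R
    have := h₂ R
    simp only [kuroda, neg, size]
    nlinarith
  | all φ h | ex φ h =>
    have := h R.shift
    rw [size_shift] at this
    simp only [kuroda, neg, size, size_shift]
    nlinarith

end Formula

/-! ### Intuitionistic derivations with bounds on the number and size of sequents. -/

theorem exists_not_mem_freeVars (s : Sequent L) : ∃ a, a ∉ s.freeVars := by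
  have : s.freeVars = ⋃ φ ∈ {φ | φ ∈ s.ante ++ s.succ}, φ.freeVars := by
    ext; simp [Sequent.freeVars]
  have hf : s.freeVars.Finite := by
    rw [this]
    exact (List.finite_toSet _).biUnion fun φ _ => φ.finite_freeVars
  exact hf.infinite_compl.nonempty

/-- The number of symbols of a list of formulas. -/
def listSize (Γ : List (Formula L)) : ℕ := (Γ.map Formula.size).sum

@[simp] theorem listSize_nil : listSize ([] : List (Formula L)) = 0 := rfl

@[simp] theorem listSize_cons (φ : Formula L) (Γ : List (Formula L)) :
    listSize (φ :: Γ) = φ.size + listSize Γ := by simp [listSize]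

@[simp] theorem listSize_append (Γ Δ : List (Formula L)) :
    listSize (Γ ++ Δ) = listSize Γ + listSize Δ := by simp [listSize]

theorem length_le_listSize (Γ : List (Formula L)) : Γ.length ≤ listSize Γ := by
  induction Γ with
  | nil => simp
  | cons φ Γ ih => have := φ.size_pos; simp only [List.length_cons, listSize_cons]; omega

theorem Derivation.mem_sequents {T : Theory L} {s : Sequent L} (d : Derivation T s) :
    s ∈ d.sequents := by
  cases d <;> simp [sequents]

/-- `Γ ⇒ C` has an intuitionistic derivation of at most `n` sequents, each of size at most `K`. -/
def Lines (T : Theory L) (K n : ℕ) (Γ : List (Formula L)) (C : Formula L) : Prop :=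
  ∃ d : Derivation T ⟨Γ, [C]⟩, d.IsIntuitionistic ∧ d.sequents.length ≤ n ∧
    ∀ s ∈ d.sequents, s.size ≤ K

namespace Lines

variable {T : Theory L} {K n m : ℕ} {Γ Γ' : List (Formula L)} {A B C : Formula L}

theorem mono (h : Lines T K n Γ C) (hnm : n ≤ m) : Lines T K m Γ C := by
  obtain ⟨d, h₁, h₂, h₃⟩ := h
  exact ⟨d, h₁, h₂.trans hnm, h₃⟩

theorem size_le (h : Lines T K n Γ C) : 1 + listSize Γ + C.size ≤ K := by
  obtain ⟨d, -, -, h⟩ := h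
  have := h ⟨Γ, [C]⟩ d.mem_sequents
  simpa [Sequent.size, listSize] using this

theorem of_zero_premises (d : Derivation T ⟨Γ, [C]⟩) (hd : d.sequents = [⟨Γ, [C]⟩])
    (hK : 1 + listSize Γ + C.size ≤ K) : Lines T K 1 Γ C :=
  ⟨d, by simp [Derivation.IsIntuitionistic, Sequent.IsIntuitionistic, hd], by simp [hd],
    by simpa [hd, Sequent.size, listSize] using hK⟩

/-- An inference, given as a function `f`, adds only its lower sequent, so the size bound needs
checking only there. -/
theorem of_one_premise (h : Lines T K n Γ C)
    (f : Derivation T ⟨Γ, [C]⟩ → Derivation T ⟨Γ', [A]⟩)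
    (hf : ∀ d, (f d).sequents = ⟨Γ', [A]⟩ :: d.sequents)
    (hK : 1 + listSize Γ' + A.size ≤ K) : Lines T K (n + 1) Γ' A := by
  obtain ⟨d, h₁, h₂, h₃⟩ := h
  refine ⟨f d, ?_, ?_, ?_⟩
  · simpa [Derivation.IsIntuitionistic, hf, Sequent.IsIntuitionistic] using h₁
  · simpa [hf] using h₂
  · simp only [hf, List.mem_cons, forall_eq_or_imp]
    exact ⟨by simpa [Sequent.size, listSize] using hK, h₃⟩

theorem of_two_premises {Γ'' : List (Formula L)} (h : Lines T K n Γ C) (h' : Lines T K m Γ' B)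
    (f : Derivation T ⟨Γ, [C]⟩ → Derivation T ⟨Γ', [B]⟩ → Derivation T ⟨Γ'', [A]⟩)
    (hf : ∀ d e, (f d e).sequents = ⟨Γ'', [A]⟩ :: (d.sequents ++ e.sequents))
    (hK : 1 + listSize Γ'' + A.size ≤ K) : Lines T K (n + m + 1) Γ'' A := by
  obtain ⟨d, h₁, h₂, h₃⟩ := h
  obtain ⟨e, g₁, g₂, g₃⟩ := h'
  refine ⟨f d e, ?_, ?_, ?_⟩
  · intro s hs
    simp only [hf, List.mem_cons, List.mem_append] at hs
    rcases hs with rfl | hs | hs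
    exacts [by simp [Sequent.IsIntuitionistic], h₁ s hs, g₁ s hs]
  · simp only [hf, List.length_cons, List.length_append]; omega
  · intro s hs
    simp only [hf, List.mem_cons, List.mem_append] at hs
    rcases hs with rfl | hs | hs
    exacts [by simpa [Sequent.size, listSize] using hK, h₃ s hs, g₃ s hs]

theorem init (hK : 1 + 2 * A.size ≤ K) : Lines T K 1 [A] A :=
  of_zero_premises (.init A) rfl (by simp; omega)

theorem bot (hK : 2 + listSize Γ + C.size ≤ K) : Lines T K 1 (Γ ++ [.falsum]) C :=
  of_zero_premises (.bot Γ [C]) rfl (by simp [Formula.size]; omega)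

theorem ax {A : {φ : Formula L // φ.freeVars = ∅}} (hA : A ∈ T)
    (hK : 1 + listSize Γ + A.val.size ≤ K) : Lines T K 1 Γ A.val :=
  of_zero_premises (.ax Γ A hA) rfl hK

theorem weakLeft (h : Lines T K n Γ C) (hK : 1 + A.size + listSize Γ + C.size ≤ K) :
    Lines T K (n + 1) (A :: Γ) C :=
  h.of_one_premise (.weakLeft A) (fun _ => rfl) (by simp; omega)

theorem contrLeft (h : Lines T K n (A :: A :: Γ) C) : Lines T K (n + 1) (A :: Γ) C :=
  h.of_one_premise .contrLeft (fun _ => rfl) (by have := h.size_le; simp at *; omega)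

theorem exchLeft (h : Lines T K n (Γ ++ A :: B :: Γ') C) :
    Lines T K (n + 1) (Γ ++ B :: A :: Γ') C :=
  h.of_one_premise .exchLeft (fun _ => rfl) (by have := h.size_le; simp at *; omega)

theorem cut (h : Lines T K n Γ A) (h' : Lines T K m (A :: Γ') C)
    (hK : 1 + listSize Γ + listSize Γ' + C.size ≤ K) : Lines T K (n + m + 1) (Γ ++ Γ') C :=
  -- With `Δ = []` the rules of `LK` specialise to one formula in the succedent, and the list
  -- appends reduce definitionally.
  h.of_two_premises h' (Derivation.cut (Δ := []) (Δ' := [C])) (fun _ _ => rfl) (by simp; omega)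

theorem andLeft₁ (h : Lines T K n (A :: Γ) C) (hK : 2 + A.size + B.size + listSize Γ + C.size ≤ K) :
    Lines T K (n + 1) (.and A B :: Γ) C :=
  h.of_one_premise (.andLeft₁ B) (fun _ => rfl) (by simp [Formula.size]; omega)

theorem andLeft₂ (h : Lines T K n (B :: Γ) C) (hK : 2 + A.size + B.size + listSize Γ + C.size ≤ K) :
    Lines T K (n + 1) (.and A B :: Γ) C :=
  h.of_one_premise (.andLeft₂ A) (fun _ => rfl) (by simp [Formula.size]; omega)

theorem andRight (h : Lines T K n Γ A) (h' : Lines T K m Γ B)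
    (hK : 2 + A.size + B.size + listSize Γ ≤ K) : Lines T K (n + m + 1) Γ (.and A B) :=
  h.of_two_premises h' (Derivation.andRight (Δ := [])) (fun _ _ => rfl)
    (by simp only [Formula.size]; omega)

theorem orLeft (h : Lines T K n (A :: Γ) C) (h' : Lines T K m (B :: Γ) C)
    (hK : 2 + A.size + B.size + listSize Γ + C.size ≤ K) :
    Lines T K (n + m + 1) (.or A B :: Γ) C :=
  h.of_two_premises h' .orLeft (fun _ _ => rfl) (by simp [Formula.size]; omega)

theorem orRight₁ (h : Lines T K n Γ A) (hK : 2 + A.size + B.size + listSize Γ ≤ K) :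
    Lines T K (n + 1) Γ (.or A B) :=
  h.of_one_premise (Derivation.orRight₁ (Δ := []) B) (fun _ => rfl)
    (by simp only [Formula.size]; omega)

theorem orRight₂ (h : Lines T K n Γ B) (hK : 2 + A.size + B.size + listSize Γ ≤ K) :
    Lines T K (n + 1) Γ (.or A B) :=
  h.of_one_premise (Derivation.orRight₂ (Δ := []) A) (fun _ => rfl)
    (by simp only [Formula.size]; omega)

theorem impLeft (h : Lines T K n Γ A) (h' : Lines T K m (B :: Γ') C)
    (hK : 2 + A.size + B.size + listSize Γ + listSize Γ' + C.size ≤ K) :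
    Lines T K (n + m + 1) (.imp A B :: (Γ ++ Γ')) C :=
  h.of_two_premises h' (Derivation.impLeft (Δ := []) (Δ' := [C])) (fun _ _ => rfl)
    (by simp [Formula.size]; omega)

theorem impRight (h : Lines T K n (A :: Γ) B) (hK : 2 + A.size + B.size + listSize Γ ≤ K) :
    Lines T K (n + 1) Γ (.imp A B) :=
  h.of_one_premise (Derivation.impRight (Δ := [])) (fun _ => rfl)
    (by simp only [Formula.size]; omega)

theorem allLeft (t : L.Term ℕ) (h : Lines T K n (A.inst t :: Γ) C)
    (hK : 3 + A.size + listSize Γ + C.size ≤ K) : Lines T K (n + 1) (.all A :: Γ) C :=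
  h.of_one_premise (.allLeft t) (fun _ => rfl) (by simp [Formula.size]; omega)

theorem allRight (a : ℕ) (ha : a ∉ Sequent.freeVars ⟨Γ, [.all A]⟩)
    (h : Lines T K n Γ (A.inst (.var a))) (hK : 3 + A.size + listSize Γ ≤ K) :
    Lines T K (n + 1) Γ (.all A) :=
  h.of_one_premise (Derivation.allRight (Δ := []) a ha) (fun _ => rfl)
    (by simp only [Formula.size]; omega)

theorem exLeft (a : ℕ) (ha : a ∉ Sequent.freeVars ⟨.ex A :: Γ, [C]⟩)
    (h : Lines T K n (A.inst (.var a) :: Γ) C) (hK : 3 + A.size + listSize Γ + C.size ≤ K) :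
    Lines T K (n + 1) (.ex A :: Γ) C :=
  h.of_one_premise (.exLeft a ha) (fun _ => rfl) (by simp [Formula.size]; omega)

theorem exRight (t : L.Term ℕ) (h : Lines T K n Γ (A.inst t)) (hK : 3 + A.size + listSize Γ ≤ K) :
    Lines T K (n + 1) Γ (.ex A) :=
  h.of_one_premise (Derivation.exRight (Δ := []) t) (fun _ => rfl)
    (by simp only [Formula.size]; omega)

theorem move_front (Γ₁ Γ₂ : List (Formula L)) (h : Lines T K n (Γ₁ ++ A :: Γ₂) C) :
    Lines T K (n + Γ₁.length) (A :: Γ₁ ++ Γ₂) C := by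
  induction Γ₁ using List.reverseRecOn generalizing n Γ₂ with
  | nil => exact h
  | append_singleton Γ₁ B ih =>
    rw [List.append_assoc] at h
    have := ih (B :: Γ₂) h.exchLeft
    simp only [List.length_append, List.length_singleton]
    rw [show n + (Γ₁.length + 1) = n + 1 + Γ₁.length by omega]
    simpa using this

theorem move_back (Γ₁ Γ₂ : List (Formula L)) (h : Lines T K n (A :: Γ₁ ++ Γ₂) C) :
    Lines T K (n + Γ₁.length) (Γ₁ ++ A :: Γ₂) C := by
  induction Γ₁ using List.reverseRecOn generalizing n Γ₂ with
  | nil => exact h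
  | append_singleton Γ₁ B ih =>
    have := ih (B :: Γ₂) (by simpa using h)
    simp only [List.length_append, List.length_singleton]
    rw [← Nat.add_assoc, List.append_assoc]
    exact this.exchLeft

/-- Exchanges bring the second copy of `A` next to the first, a contraction merges them, and
exchanges carry the result back. -/
theorem absorb (hA : A ∈ Γ) (h : Lines T K n (A :: Γ) C) :
    Lines T K (n + 2 * Γ.length + 1) Γ C := by
  obtain ⟨Γ₁, Γ₂, rfl⟩ := List.append_of_mem hA
  have := (move_front (A :: Γ₁) Γ₂ h).contrLeft.move_back
  refine this.mono ?_
  simp only [List.length_cons, List.length_append]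
  omega

theorem absorb_append (hΓ : Γ ⊆ Γ') (h : Lines T K n (Γ' ++ Γ) C) :
    Lines T K (n + Γ.length * (3 * (Γ.length + Γ'.length) + 1)) Γ' C := by
  induction Γ generalizing n with
  | nil => simpa using h
  | cons A Γ ih =>
    have hA := List.cons_subset.1 hΓ
    have := ih hA.2 ((move_front Γ' Γ h).absorb (List.mem_append_left _ hA.1))
    refine this.mono ?_
    simp only [List.length_cons, List.length_append]
    nlinarith

theorem weakLeft_append (h : Lines T K n Γ C) (hK : 1 + listSize Γ' + listSize Γ + C.size ≤ K) :
    Lines T K (n + Γ'.length) (Γ' ++ Γ) C := by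
  induction Γ' with
  | nil => exact h
  | cons A Γ' ih =>
    simp only [listSize_cons] at hK
    exact (ih (by omega)).weakLeft (by simp; omega)

/-- Weaken by all of `Γ'`, then absorb `Γ` formula by formula. Lists have length at most `K`, so
this takes at most `K + K * (3 * K + 1)` inferences. The intermediate sequent contains both lists,
whence the size hypothesis. -/
theorem of_subset (h : Lines T K n Γ C) (hΓ : Γ ⊆ Γ')
    (hK : 1 + listSize Γ' + listSize Γ + C.size ≤ K) : Lines T K (n + 5 * K ^ 2) Γ' C := by
  refine ((h.weakLeft_append hK).absorb_append hΓ).mono ?_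
  have h₁ := length_le_listSize Γ
  have h₂ := length_le_listSize Γ'
  have h₃ : Γ.length + Γ'.length ≤ K := by omega
  have h₄ : 1 ≤ K := by omega
  have h₅ : Γ.length * (3 * (Γ.length + Γ'.length) + 1) ≤ K * (3 * K + 1) := by
    gcongr
    omega
  have h₆ : Γ'.length ≤ K := by omega
  nlinarith

end Lines

/-! ### Derived rules with a coarse count of inferences. -/

/-- Intuitionistic derivability of `Γ ⇒ C` with sequents of size at most `K`, where the number of
sequents is counted in units large enough for rearranging the antecedent. -/
def Prv (T : Theory L) (K n : ℕ) (Γ : List (Formula L)) (C : Formula L) : Prop :=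
  Lines T K (n * (20 * K ^ 2)) Γ C

namespace Prv

variable {T : Theory L} {K W n m : ℕ} {Γ Γ' : List (Formula L)} {A B C R X : Formula L}

theorem mono (h : Prv T K n Γ C) (hnm : n ≤ m) : Prv T K m Γ C :=
  Lines.mono h (Nat.mul_le_mul_right _ hnm)

/-- One unit pays for `a` single inferences and `b` rearrangements of the antecedent, each of the
latter costing `5 * K ^ 2`. -/
theorem of_lines {a b : ℕ} (h : Lines T K (n * (20 * K ^ 2) + a + b * (5 * K ^ 2)) Γ C)
    (hab : a + 5 * b ≤ 20) : Prv T K (n + 1) Γ C := by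
  refine Lines.mono h ?_
  have h₁ : 1 ≤ K := by have := h.size_le; omega
  have h₂ : 1 ≤ K ^ 2 := Nat.one_le_pow _ _ h₁
  nlinarith

theorem weak (h : Prv T K n Γ C) (hΓ : Γ ⊆ Γ') (hK : 1 + listSize Γ' + listSize Γ + C.size ≤ K) :
    Prv T K (n + 1) Γ' C :=
  of_lines (a := 0) (b := 1) ((Lines.of_subset h hΓ hK).mono (by omega)) (by norm_num)

theorem hyp (hC : C ∈ Γ) (hK : 1 + listSize Γ + 2 * C.size ≤ K) : Prv T K 1 Γ C :=
  of_lines (n := 0) (a := 1) (b := 1)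
    (((Lines.init (by omega)).of_subset (by simpa using hC) (by simp; omega)).mono (by omega))
    (by norm_num)

theorem bot (hC : .falsum ∈ Γ) (hK : 2 + listSize Γ + C.size ≤ K) : Prv T K 1 Γ C :=
  of_lines (n := 0) (a := 1) (b := 1)
    (((Lines.bot (Γ := []) (by simp; omega)).of_subset (by simpa using hC)
      (by simp [Formula.size]; omega)).mono (by omega)) (by norm_num)

theorem ax {A : {φ : Formula L // φ.freeVars = ∅}} (hA : A ∈ T)
    (hK : 1 + listSize Γ + A.val.size ≤ K) : Prv T K 1 Γ A.val :=
  of_lines (n := 0) (a := 1) (b := 0) ((Lines.ax hA hK).mono (by omega)) (by norm_num)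

theorem impI (h : Prv T K n (A :: Γ) B) (hK : 2 + A.size + B.size + listSize Γ ≤ K) :
    Prv T K (n + 1) Γ (.imp A B) :=
  of_lines (a := 1) (b := 0) ((Lines.impRight h hK).mono (by omega)) (by norm_num)

theorem cut (h : Prv T K n Γ A) (h' : Prv T K m (A :: Γ) C)
    (hK : 1 + 3 * listSize Γ + C.size ≤ K) : Prv T K (n + m + 1) Γ C :=
  of_lines (a := 1) (b := 1)
    (((Lines.cut h h' (by omega)).of_subset (by simp) (by simp; omega)).mono (by linarith))
    (by norm_num)

theorem mp (h : Prv T K n Γ (.imp A B)) (h' : Prv T K m Γ A)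
    (hK : 2 + 3 * listSize Γ + A.size + 2 * B.size ≤ K) : Prv T K (n + m + 1) Γ B :=
  of_lines (a := 3) (b := 1)
    (((Lines.cut h (Lines.impLeft h' (Lines.init (A := B) (by omega)) (by simp; omega))
      (by simp; omega)).of_subset (by simp) (by simp; omega)).mono (by linarith))
    (by norm_num)

theorem orI₁ (h : Prv T K n Γ A) (hK : 2 + A.size + B.size + listSize Γ ≤ K) :
    Prv T K (n + 1) Γ (.or A B) :=
  of_lines (a := 1) (b := 0) ((Lines.orRight₁ h hK).mono (by omega)) (by norm_num)

theorem orI₂ (h : Prv T K n Γ B) (hK : 2 + A.size + B.size + listSize Γ ≤ K) :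
    Prv T K (n + 1) Γ (.or A B) :=
  of_lines (a := 1) (b := 0) ((Lines.orRight₂ h hK).mono (by omega)) (by norm_num)

theorem andI (h : Prv T K n Γ A) (h' : Prv T K m Γ B) (hK : 2 + A.size + B.size + listSize Γ ≤ K) :
    Prv T K (n + m + 1) Γ (.and A B) :=
  of_lines (a := 1) (b := 0) ((Lines.andRight h h' hK).mono (by linarith)) (by norm_num)

theorem exI (t : L.Term ℕ) (h : Prv T K n Γ (A.inst t)) (hK : 3 + A.size + listSize Γ ≤ K) :
    Prv T K (n + 1) Γ (.ex A) :=
  of_lines (a := 1) (b := 0) ((Lines.exRight t h hK).mono (by omega)) (by norm_num)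

theorem allI_of_not_mem (a : ℕ) (ha : a ∉ Sequent.freeVars ⟨Γ, [.all A]⟩)
    (h : Prv T K n Γ (A.inst (.var a))) (hK : 3 + A.size + listSize Γ ≤ K) :
    Prv T K (n + 1) Γ (.all A) :=
  of_lines (a := 1) (b := 0) ((Lines.allRight a ha h hK).mono (by omega)) (by norm_num)

/-- Asking for the premise at every variable removes the eigenvariable condition from later
arguments: a fresh variable is chosen only here. -/
theorem allI (h : ∀ a, Prv T K n Γ (A.inst (.var a))) (hK : 3 + A.size + listSize Γ ≤ K) :
    Prv T K (n + 1) Γ (.all A) := by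
  obtain ⟨a, ha⟩ := exists_not_mem_freeVars ⟨Γ, [.all A]⟩
  exact allI_of_not_mem a ha (h a) hK

theorem allE (t : L.Term ℕ) (h : Prv T K n Γ (.all A))
    (hK : 3 + A.size + listSize Γ + 2 * (A.inst t).size ≤ K) : Prv T K (n + 1) Γ (A.inst t) := by
  refine of_lines (a := 3) (b := 0) (Lines.mono (n := n * (20 * K ^ 2) + (1 + 1) + 1) ?_ (by omega))
    (by norm_num)
  have := Lines.cut h (Lines.allLeft t (Lines.init (A := A.inst t) (by omega)) (by simp; omega))
    (by simp; omega)
  simpa using this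

theorem andE₁ (hX : .and A B ∈ Γ) (h : Prv T K n (A :: Γ) C)
    (hK : 2 + A.size + B.size + 2 * listSize Γ + C.size ≤ K) : Prv T K (n + 1) Γ C :=
  of_lines (a := 1) (b := 1) (((Lines.andLeft₁ (B := B) h (by omega)).of_subset (by simpa using hX)
    (by simp [Formula.size]; omega)).mono (by omega)) (by norm_num)

theorem andE₂ (hX : .and A B ∈ Γ) (h : Prv T K n (B :: Γ) C)
    (hK : 2 + A.size + B.size + 2 * listSize Γ + C.size ≤ K) : Prv T K (n + 1) Γ C :=
  of_lines (a := 1) (b := 1) (((Lines.andLeft₂ (A := A) h (by omega)).of_subset (by simpa using hX)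
    (by simp [Formula.size]; omega)).mono (by omega)) (by norm_num)

theorem orE (hX : .or A B ∈ Γ) (h : Prv T K n (A :: Γ) C) (h' : Prv T K m (B :: Γ) C)
    (hK : 2 + A.size + B.size + 2 * listSize Γ + C.size ≤ K) : Prv T K (n + m + 1) Γ C :=
  of_lines (a := 1) (b := 1) (((Lines.orLeft h h' (by omega)).of_subset (by simpa using hX)
    (by simp [Formula.size]; omega)).mono (by linarith)) (by norm_num)

theorem exE (hX : .ex A ∈ Γ) (h : ∀ a, Prv T K n (A.inst (.var a) :: Γ) C)
    (hK : 3 + A.size + 2 * listSize Γ + C.size ≤ K) : Prv T K (n + 1) Γ C := by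
  obtain ⟨a, ha⟩ := exists_not_mem_freeVars ⟨.ex A :: Γ, [C]⟩
  exact of_lines (a := 1) (b := 1) (((Lines.exLeft a ha (h a) (by omega)).of_subset
    (by simpa using hX) (by simp [Formula.size]; omega)).mono (by omega)) (by norm_num)

/-! ### Reasoning about negations relative to `R` -/

/-- Here and below `W` bounds the formulas in play; the factor `20` leaves room for all intermediate
sequents. -/
theorem contradiction (hX : neg R X ∈ Γ) (h : Prv T K n Γ X)
    (hW : 20 * W ≤ K) (hΓ : listSize Γ + X.size + R.size + 1 ≤ W) : Prv T K (n + 2) Γ R :=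
  (mp (hyp hX (by simp only [Formula.size]; omega)) h (by omega)).mono (by omega)

/-- The second premise proves `¬A`, which is cut into the first. For the goal `R` this replaces the
case distinction on `A`. -/
theorem neg_cut (h : Prv T K n (neg R A :: Γ) R) (h' : Prv T K m (A :: Γ) R)
    (hW : 20 * W ≤ K) (hΓ : listSize Γ + A.size + R.size + 1 ≤ W) : Prv T K (n + m + 2) Γ R :=
  (cut (impI h' (by omega)) h (by omega)).mono (by omega)

/-- The common pattern of the right rules for `∨` and `∃`, also used for `∧`: `A` implies the
principal formula `X`, so `¬X` refutes `A`. -/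
theorem right_rule (hX : neg R X ∈ Γ) (h : Prv T K n (A :: Γ) X) (h' : Prv T K m (neg R A :: Γ) R)
    (hW : 20 * W ≤ K) (hΓ : listSize Γ + A.size + X.size + R.size + 1 ≤ W) :
    Prv T K (n + m + 4) Γ R :=
  (neg_cut h' (contradiction (W := W) (List.mem_cons_of_mem _ hX) h hW (by simp; omega)) hW
    (by omega)).mono (by omega)

theorem neg_and (hX : neg R (.and A B) ∈ Γ) (h : Prv T K n (neg R A :: Γ) R)
    (h' : Prv T K m (neg R B :: Γ) R) (hW : 20 * W ≤ K)
    (hΓ : 2 * listSize Γ + 4 * A.size + 4 * B.size + 4 * R.size + 4 ≤ W) :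
    Prv T K (n + m + 10) Γ R := by
  -- Refute `A` first; under the assumption `A`, the formula `B` implies `A ∧ B`.
  refine (neg_cut (W := W) (A := A) (n := n) (m := m + 1 + 3 + 4) h ?_ hW (by omega)).mono
    (by omega)
  refine (right_rule (W := W) (A := B) (n := 3) (m := m + 1) (List.mem_cons_of_mem _ hX) ?_ ?_ hW
    (by simp [Formula.size]; omega)).mono (by omega)
  · exact (andI (hyp (by simp) (by simp; omega)) (hyp (by simp) (by simp; omega))
      (by simp; omega)).mono (by omega)
  · exact h'.weak (by intro; simp; tauto) (by simp [neg, Formula.size]; omega)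

theorem neg_or₁ (hX : neg R (.or A B) ∈ Γ) (h : Prv T K n (neg R A :: Γ) R) (hW : 20 * W ≤ K)
    (hΓ : 2 * listSize Γ + 4 * A.size + 4 * B.size + 4 * R.size + 4 ≤ W) :
    Prv T K (n + 10) Γ R :=
  (right_rule (W := W) hX (orI₁ (hyp (by simp) (by simp; omega)) (by simp; omega)) h hW
    (by simp [Formula.size]; omega)).mono (by omega)

theorem neg_or₂ (hX : neg R (.or A B) ∈ Γ) (h : Prv T K n (neg R B :: Γ) R) (hW : 20 * W ≤ K)
    (hΓ : 2 * listSize Γ + 4 * A.size + 4 * B.size + 4 * R.size + 4 ≤ W) :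
    Prv T K (n + 10) Γ R :=
  (right_rule (W := W) hX (orI₂ (hyp (by simp) (by simp; omega)) (by simp; omega)) h hW
    (by simp [Formula.size]; omega)).mono (by omega)

theorem neg_ex (t : L.Term ℕ) (hX : neg R (.ex A) ∈ Γ) (h : Prv T K n (neg R (A.inst t) :: Γ) R)
    (hW : 20 * W ≤ K)
    (hΓ : 2 * listSize Γ + 4 * A.size + 4 * (A.inst t).size + 4 * R.size + 4 ≤ W) :
    Prv T K (n + 10) Γ R :=
  (right_rule (W := W) hX (exI t (hyp (by simp) (by simp; omega)) (by simp; omega)) h hW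
    (by simp [Formula.size]; omega)).mono (by omega)

/-- The premise gives `A → ¬¬B`, but in general not `A → B`: hence the `¬¬` in the translation of
`→`. -/
theorem neg_imp (hX : neg R (.imp A (neg R (neg R B))) ∈ Γ)
    (h : Prv T K n (A :: neg R B :: Γ) R) (hW : 20 * W ≤ K)
    (hΓ : 2 * listSize Γ + 4 * A.size + 4 * B.size + 4 * R.size + 4 ≤ W) :
    Prv T K (n + 10) Γ R := by
  refine (contradiction (W := W) (n := n + 3) hX (impI (impI (n := n + 1) ?_ ?_) ?_) hW ?_).mono
    (by omega)
  · exact h.weak (by intro; simp; tauto) (by simp [neg, Formula.size]; omega)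
  all_goals simp [neg, Formula.size]; omega

/-- The premises give `¬¬B(a)` for fresh `a`, which is enough because the translation has `¬¬` below
`∀`. -/
theorem neg_all (hX : neg R (.all (neg R.shift (neg R.shift B))) ∈ Γ)
    (h : ∀ a, Prv T K n (neg R (B.inst (.var a)) :: Γ) R) (hW : 20 * W ≤ K)
    (hΓ : 2 * listSize Γ + 4 * B.size + 8 * R.size + 8 ≤ W) :
    Prv T K (n + 10) Γ R := by
  refine (contradiction (W := W) (n := n + 2) hX (allI (n := n + 1) (fun a => ?_) ?_) hW ?_).mono
    (by omega)
  · have := impI (h a) (by simp [neg, Formula.size, size_inst_var]; omega)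
    rw [neg_neg_inst]
    exact this
  all_goals simp [neg, Formula.size, size_shift]; omega

theorem imp_left (hX : .imp A (neg R (neg R B)) ∈ Γ) (h : Prv T K n (neg R A :: Γ) R)
    (h' : Prv T K m (B :: Γ) R) (hW : 20 * W ≤ K)
    (hΓ : 2 * listSize Γ + 4 * A.size + 4 * B.size + 4 * R.size + 8 ≤ W) :
    Prv T K (n + m + 10) Γ R := by
  refine (neg_cut (W := W) (A := A) (n := n) (m := 3 + (m + 2) + 1) h ?_ hW (by omega)).mono
    (by omega)
  refine mp (A := neg R B) (mp (n := 1) (m := 1) (A := A) ?_ ?_ ?_)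
    (impI (n := m + 1) (h'.weak ?_ ?_) ?_) ?_
  · exact hyp (List.mem_cons_of_mem _ hX) (by simp [neg, Formula.size]; omega)
  · exact hyp (by simp) (by simp; omega)
  · simp [neg, Formula.size]; omega
  · intro; simp; tauto
  all_goals simp [neg, Formula.size]; omega

/-- A premise `¬¬B(t)` is as good as `B(t)` when the goal is `R`. -/
theorem all_left (t : L.Term ℕ) (hX : .all (neg R.shift (neg R.shift B)) ∈ Γ)
    (h : Prv T K n (B.inst t :: Γ) R) (hW : 20 * W ≤ K)
    (hΓ : 2 * listSize Γ + 4 * B.size + 4 * (B.inst t).size + 8 * R.size + 8 ≤ W) :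
    Prv T K (n + 10) Γ R := by
  have h₁ : Prv T K 2 Γ (neg R (neg R (B.inst t))) := by
    rw [← neg_neg_inst]
    refine allE (n := 1) t (hyp hX ?_) ?_
    · simp [neg, Formula.size, size_shift]; omega
    · rw [neg_neg_inst]
      simp [neg, Formula.size, size_shift]; omega
  exact (mp h₁ (impI h (by omega)) (by simp [neg, Formula.size]; omega)).mono (by omega)

end Prv

/-! ### Geometric implications and their translations. -/

namespace Prv

variable {T : Theory L} {K W n m : ℕ} {Γ Γ' : List (Formula L)} {A B C R X : Formula L}

/-- A geometric implication entails its translation. -/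
theorem kuroda_of_isGeometricImplication {ψ : Formula L} (hψ : ψ.IsGeometricImplication)
    (hW : 20 * W ≤ K) (hΓ : 2 * listSize Γ + (20 * R.size + 20) * ψ.size ≤ W)
    (h : Prv T K n Γ ψ) : Prv T K (n + 20 * ψ.size) Γ (kuroda R ψ) := by
  induction hψ using IsGeometricImplication.induction_inst generalizing n with
  | positive φ hφ =>
    rw [hφ.kuroda_eq]
    exact h.mono (by omega)
  | imp φ ψ hφ hψ =>
    simp only [kuroda, hφ.kuroda_eq, hψ.kuroda_eq]
    simp only [Formula.size] at hΓ ⊢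
    have := φ.size_pos
    refine (impI (impI (n := 1 + (n + 3) + 1) (mp (n := 1) (m := n + 3) (A := ψ) (hyp ?_ ?_)
      (mp (n := n + 1) (m := 1) (A := φ) (h.weak ?_ ?_) (hyp ?_ ?_) ?_) ?_) ?_) ?_).mono (by omega)
    any_goals simp [neg, Formula.size]; done
    all_goals simp [neg, Formula.size]; nlinarith
  | all φ _ ih =>
    simp only [kuroda]
    simp only [Formula.size] at hΓ ⊢
    refine (allI (n := n + 20 * φ.size + 10) (fun a => ?_) ?_).mono (by omega)
    · have hs := size_kuroda_le R (φ.inst (.var a))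
      have hi := ih a (n := n + 1) (by rw [size_inst_var]; nlinarith)
        (h.allE (.var a) (by simp only [size_inst_var]; nlinarith))
      rw [size_inst_var] at hs hi
      rw [neg_neg_inst, kuroda_inst]
      refine (impI (n := n + 1 + 20 * φ.size + 3) (contradiction (W := W)
        (n := n + 1 + 20 * φ.size + 1) (List.mem_cons_self ..) (hi.weak ?_ ?_) hW ?_) ?_).mono
        (by omega)
      · intro; simp; tauto
      all_goals simp [neg, Formula.size]; nlinarith
    · have hs := size_kuroda_le R.shift φ
      rw [size_shift] at hs
      simp [neg, Formula.size, size_shift]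
      nlinarith

end Prv

/-- For a geometric implication `∀ x, (α → β)` and fresh variables `a`, the sequent
`α(a) ⇒ β(a)`. -/
theorem Formula.IsGeometricImplication.exists_sequent {φ : Formula L}
    (hφ : φ.IsGeometricImplication) : ∃ (Γ : List (Formula L)) (R : Formula L),
      listSize Γ + R.size ≤ φ.size ∧
      ∀ (T : Theory L) (K W : ℕ), 20 * W ≤ K → (20 * R.size + 40) * φ.size ≤ W →
        Prv T K (20 * φ.size) (kuroda R φ :: Γ) R ∧
        ∀ n, Prv T K n Γ R → Prv T K (n + φ.size) [] φ := by
  induction hφ using IsGeometricImplication.induction_inst with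
  | positive φ hφ =>
    refine ⟨[], φ, by simp, fun T K W hW hφW => ⟨?_, fun n h => h.mono (by omega)⟩⟩
    rw [hφ.kuroda_eq]
    have := φ.size_pos
    exact (Prv.hyp (by simp) (by simp; nlinarith)).mono (by omega)
  | imp α β hα hβ =>
    -- With `R = β`, the translation `α → ¬¬β` and the hypothesis `α` give `R`.
    refine ⟨[α], β, by simp [Formula.size], fun T K W hW hφW => ⟨?_, fun n h => ?_⟩⟩
    · simp only [kuroda, hα.kuroda_eq, hβ.kuroda_eq]
      simp only [Formula.size] at hφW ⊢
      have := α.size_pos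
      refine (Prv.imp_left (A := α) (B := β) (W := W) (n := 3) (m := 1) (by simp)
        (Prv.contradiction (W := W) (X := α) (n := 1) (by simp) (Prv.hyp (by simp) ?_) hW ?_)
        (Prv.hyp (by simp) ?_) hW ?_).mono (by omega)
      all_goals simp [neg, Formula.size]; nlinarith
    · simp only [Formula.size] at hφW ⊢
      exact (h.impI (by simp; nlinarith)).mono (by omega)
  | all φ _ ih =>
    -- `a` may occur in `Γ` and `R`; it need only be fresh for `∀ x, φ`, since the generalisation
    -- happens after `Γ` has been discharged.
    obtain ⟨a, ha⟩ := exists_not_mem_freeVars (L := L) ⟨[], [.all φ]⟩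
    obtain ⟨Γ, R, hΓ, H⟩ := ih a
    rw [size_inst_var] at hΓ
    refine ⟨Γ, R, by simp only [Formula.size]; omega, fun T K W hW hφW => ?_⟩
    simp only [Formula.size] at hφW ⊢
    obtain ⟨h₁, h₂⟩ := H T K W hW (by rw [size_inst_var]; nlinarith)
    rw [size_inst_var] at h₁ h₂
    refine ⟨?_, fun n h => ?_⟩
    · have hs := size_kuroda_le R (φ.inst (.var a))
      have hs' := size_kuroda_le R.shift φ
      rw [size_inst_var] at hs
      rw [size_shift] at hs'
      rw [← kuroda_inst] at h₁ hs
      simp only [kuroda]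
      refine (Prv.all_left (W := W) (n := 20 * φ.size + 1) (.var a) (List.mem_cons_self ..)
        (h₁.weak ?_ ?_) hW ?_).mono (by omega)
      · intro; simp; tauto
      all_goals simp [neg, Formula.size, size_shift]; nlinarith
    · exact (Prv.allI_of_not_mem a ha (h₂ n h) (by simp; nlinarith)).mono (by omega)

/-! ### Translated sequents. -/

/-- The translation of a formula relative to `R`, after renaming its free variables. -/
def translate (R : Formula L) (ρ : ℕ → ℕ) (φ : Formula L) : Formula L :=
  kuroda R (φ.subst fun n => .var (ρ n))

/-- The antecedent of the translation of a sequent; the succedent is `R`. -/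
def Sequent.translate (R : Formula L) (ρ : ℕ → ℕ) (s : Sequent L) : List (Formula L) :=
  s.ante.map (SequentCalculus.translate R ρ) ++
    s.succ.map fun φ => neg R (SequentCalculus.translate R ρ φ)

/-- The extra `R.size + 1` pays for the negation in front of a succedent formula. -/
theorem size_translate_le (R : Formula L) (ρ : ℕ → ℕ) (φ : Formula L) :
    (translate R ρ φ).size + R.size + 1 ≤ (3 * R.size + 4) * φ.size := by
  have h := size_kuroda_le R (φ.subst fun n => .var (ρ n))
  rw [size_rename] at h
  have := φ.size_pos
  unfold translate
  nlinarith

theorem Sequent.listSize_translate_le (R : Formula L) (ρ : ℕ → ℕ) (s : Sequent L) :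
    listSize (s.translate R ρ) ≤ (3 * R.size + 4) * s.size := by
  have h₁ (Γ : List (Formula L)) :
      listSize (Γ.map (SequentCalculus.translate R ρ)) ≤ (3 * R.size + 4) * listSize Γ := by
    induction Γ with
    | nil => simp
    | cons φ Γ ih =>
      have := size_translate_le R ρ φ
      simp only [List.map_cons, listSize_cons]
      nlinarith
  have h₂ (Γ : List (Formula L)) :
      listSize (Γ.map fun φ => neg R (SequentCalculus.translate R ρ φ)) ≤
        (3 * R.size + 4) * listSize Γ := by
    induction Γ with
    | nil => simp
    | cons φ Γ ih =>
      have := size_translate_le R ρ φ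
      simp only [List.map_cons, listSize_cons, neg, Formula.size] at ih ⊢
      nlinarith
  have := h₁ s.ante
  have := h₂ s.succ
  have e : s.size = 1 + listSize s.ante + listSize s.succ := rfl
  simp only [translate, listSize_append, e]
  nlinarith

theorem Derivation.size_eq_of_one {T : Theory L} {s s' : Sequent L} {d : Derivation T s}
    {e : Derivation T s'} (h : e.sequents = s' :: d.sequents) : e.size = s'.size + d.size := by
  simp [size, h]

theorem Derivation.size_eq_of_two {T : Theory L} {s s₁ s₂ : Sequent L} {d₁ : Derivation T s₁}
    {d₂ : Derivation T s₂} {e : Derivation T s}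
      (h : e.sequents = s :: (d₁.sequents ++ d₂.sequents)) :
    e.size = s.size + d₁.size + d₂.size := by
  simp [size, h, add_assoc]

theorem Derivation.sequent_size_le {T : Theory L} {s : Sequent L} (d : Derivation T s) :
    s.size ≤ d.size :=
  List.single_le_sum (by simp) _ (List.mem_map_of_mem d.mem_sequents)

theorem translate_update {R φ : Formula L} {a : ℕ} (ha : a ∉ φ.freeVars) (ρ : ℕ → ℕ) (b : ℕ) :
    translate R (Function.update ρ a b) φ = translate R ρ φ := by
  unfold translate
  congr 1
  refine subst_congr φ fun n hn => ?_
  rw [Function.update_of_ne]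
  rintro rfl
  exact ha hn

theorem Prv.of_translate {T : Theory L} {K Q n : ℕ} {R : Formula L} {ρ : ℕ → ℕ} {s : Sequent L}
    {Γ : List (Formula L)} (h : Prv T K n (s.translate R ρ) R) (hsub : s.translate R ρ ⊆ Γ)
    (hK : 600 * Q ≤ K) (hs : (3 * R.size + 4) * s.size ≤ Q) (hΓ : listSize Γ ≤ 10 * Q) :
    Prv T K (n + 1) Γ R := by
  refine h.weak hsub ?_
  have := s.listSize_translate_le R ρ
  have : 1 ≤ s.size := by simp only [Sequent.size]; omega
  nlinarith

theorem Sequent.translate_update {R : Formula L} {s : Sequent L} {a : ℕ} (ha : a ∉ s.freeVars)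
    (ρ : ℕ → ℕ) (b : ℕ) : s.translate R (Function.update ρ a b) = s.translate R ρ := by
  unfold translate
  congr 1 <;> refine List.map_congr_left fun φ hφ => ?_
  · exact SequentCalculus.translate_update (fun h => ha ⟨φ, List.mem_append_left _ hφ, h⟩) ρ b
  · rw [SequentCalculus.translate_update (fun h => ha ⟨φ, List.mem_append_right _ hφ, h⟩) ρ b]

theorem translate_inst_update {R φ : Formula L} {a : ℕ} (ha : a + 1 ∉ φ.freeVars) (ρ : ℕ → ℕ)
    (b : ℕ) : translate R (Function.update ρ a b) (φ.inst (.var a)) =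
      (kuroda R.shift (φ.subst (liftSubst fun n => .var (ρ n)))).inst (.var b) := by
  unfold translate
  rw [subst_update_inst φ ha, kuroda_inst]

theorem translate_inst (R φ : Formula L) (t : L.Term ℕ) (ρ : ℕ → ℕ) :
    translate R ρ (φ.inst t) =
      (kuroda R.shift (φ.subst (liftSubst fun n => .var (ρ n)))).inst
        (t.subst fun n => .var (ρ n)) := by
  unfold translate
  rw [subst_inst, kuroda_inst]

theorem Sequent.mem_translate_left {R φ : Formula L} {ρ : ℕ → ℕ} {s : Sequent L}
    (h : φ ∈ s.ante) : SequentCalculus.translate R ρ φ ∈ s.translate R ρ :=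
  List.mem_append_left _ (List.mem_map_of_mem h)

theorem Sequent.mem_translate_right {R φ : Formula L} {ρ : ℕ → ℕ} {s : Sequent L}
    (h : φ ∈ s.succ) : neg R (SequentCalculus.translate R ρ φ) ∈ s.translate R ρ :=
  List.mem_append_right _ (List.mem_map_of_mem
    (f := fun ψ => neg R (SequentCalculus.translate R ρ ψ)) h)

/-- For a premise `s` and conclusion `s'` of a rule, `E` and `F` hold the active formulas on the
left and on the right. -/
theorem Sequent.translate_subset {R : Formula L} {ρ : ℕ → ℕ} {s s' : Sequent L}
    (E F : List (Formula L)) (hE : s.ante ⊆ E ++ s'.ante) (hF : s.succ ⊆ F ++ s'.succ) :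
    s.translate R ρ ⊆ E.map (SequentCalculus.translate R ρ) ++
      (F.map (fun φ => neg R (SequentCalculus.translate R ρ φ)) ++ s'.translate R ρ) := by
  intro x hx
  rcases List.mem_append.1 hx with hx | hx <;> obtain ⟨φ, hφ, rfl⟩ := List.mem_map.1 hx
  · rcases List.mem_append.1 (hE hφ) with h | h
    · exact List.mem_append_left _ (List.mem_map_of_mem h)
    · exact List.mem_append_right _ (List.mem_append_right _ (mem_translate_left h))
  · rcases List.mem_append.1 (hF hφ) with h | h
    · exact List.mem_append_right _ (List.mem_append_left _ (List.mem_map_of_mem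
        (f := fun φ => neg R (SequentCalculus.translate R ρ φ)) h))
    · exact List.mem_append_right _ (List.mem_append_right _ (mem_translate_right h))

theorem Sequent.translate_mono {R : Formula L} {ρ : ℕ → ℕ} {s s' : Sequent L}
    (hE : s.ante ⊆ s'.ante) (hF : s.succ ⊆ s'.succ) : s.translate R ρ ⊆ s'.translate R ρ :=
  translate_subset [] [] hE hF

theorem Sequent.translate_subset_left {R φ : Formula L} {ρ : ℕ → ℕ} {s s' : Sequent L}
    (hE : s.ante ⊆ φ :: s'.ante) (hF : s.succ ⊆ s'.succ) :
    s.translate R ρ ⊆ SequentCalculus.translate R ρ φ :: s'.translate R ρ :=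
  translate_subset [φ] [] hE hF

theorem Sequent.translate_subset_right {R φ : Formula L} {ρ : ℕ → ℕ} {s s' : Sequent L}
    (hE : s.ante ⊆ s'.ante) (hF : s.succ ⊆ φ :: s'.succ) :
    s.translate R ρ ⊆ neg R (SequentCalculus.translate R ρ φ) :: s'.translate R ρ :=
  translate_subset [] [φ] hE hF

theorem Sequent.size_le_of_mem {φ : Formula L} {s : Sequent L} (h : φ ∈ s.ante ++ s.succ) :
    φ.size ≤ s.size := by
  have h := List.single_le_sum (by simp) _ (List.mem_map_of_mem (f := Formula.size) h)
  simp only [List.map_append, List.sum_append] at h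
  unfold size
  omega

/-! ### Simulation of classical derivations. -/

set_option maxHeartbeats 1000000 in
/-- The simulation of classical derivations. -/
theorem Derivation.prv_translate {T : Theory L} (hT : T.IsGeometric) (R : Formula L) {K Q : ℕ}
    (hK : 600 * Q ≤ K) {s : Sequent L} (d : Derivation T s) (ρ : ℕ → ℕ)
    (hd : (3 * R.size + 4) * d.size ≤ Q) : Prv T K (20 * d.size) (s.translate R ρ) R := by
  have hW : 20 * (30 * Q) ≤ K := by omega
  have hpos (s : Sequent L) : 1 ≤ s.size := by simp only [Sequent.size]; omega
  have hmul {a b : ℕ} (h : (3 * R.size + 4) * a ≤ Q) (hb : b ≤ a) : (3 * R.size + 4) * b ≤ Q :=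
    (Nat.mul_le_mul_left _ hb).trans h
  have hseq {s : Sequent L} (h : (3 * R.size + 4) * s.size ≤ Q) (ρ : ℕ → ℕ) :
    listSize (s.translate R ρ) ≤ Q := (s.listSize_translate_le R ρ).trans h
  have hmem {s : Sequent L} (h : (3 * R.size + 4) * s.size ≤ Q) (ρ : ℕ → ℕ) (φ : Formula L)
      (hφ : φ ∈ s.ante ++ s.succ) : (SequentCalculus.translate R ρ φ).size + R.size + 1 ≤ Q :=
    (size_translate_le R ρ φ).trans (hmul h (Sequent.size_le_of_mem hφ))
  -- For a logical rule or cut: `X` is the translated active formula, negated if it stood on the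
  -- right, and the side formulas are enlarged to the whole conclusion.
  have hprem {s s' : Sequent L} {X : Formula L} (d : Derivation T s) {ρ : ℕ → ℕ}
      (ih : Prv T K (20 * d.size) (s.translate R ρ) R) (hd : (3 * R.size + 4) * d.size ≤ Q)
      (hs' : (3 * R.size + 4) * s'.size ≤ Q) (hX : X.size ≤ Q)
      (hsub : s.translate R ρ ⊆ X :: s'.translate R ρ) :
      Prv T K (20 * d.size + 1) (X :: s'.translate R ρ) R := by
    refine ih.of_translate hsub hK (hmul hd d.sequent_size_le) ?_
    have := hseq hs' ρ
    simp only [listSize_cons]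
    omega
  -- Structural rules only rearrange the translated antecedent.
  have hstr {s s' : Sequent L} {d : Derivation T s} {d' : Derivation T s'} {ρ : ℕ → ℕ}
      (e : d'.sequents = s' :: d.sequents)
      (ih : (3 * R.size + 4) * d.size ≤ Q → Prv T K (20 * d.size) (s.translate R ρ) R)
      (hd : (3 * R.size + 4) * d'.size ≤ Q)
      (hsub : s.translate R ρ ⊆ s'.translate R ρ) :
      Prv T K (20 * d'.size) (s'.translate R ρ) R := by
    have e := size_eq_of_one e
    have hs := hseq (hmul hd d'.sequent_size_le) ρ
    have hd := hmul hd (show d.size ≤ d'.size by omega)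
    exact ((ih hd).of_translate hsub hK (hmul hd d.sequent_size_le) (by omega)).mono
      (by have := hpos s'; omega)
  -- An eigenvariable of the classical derivation may occur in `R`, so it has to be renamed; the
  -- induction therefore ranges over all renamings, which preserve size.
  induction d generalizing ρ with
  | init φ =>
    have e : (init (T := T) φ).size = (Sequent.mk [φ] [φ]).size := by simp [size, sequents]
    rw [e] at hd ⊢
    have h₁ := hseq hd ρ
    have h₂ := hmem hd ρ φ (by simp)
    have h₃ := hpos ⟨[φ], [φ]⟩
    refine (Prv.contradiction (W := 30 * Q) (n := 1) (X := SequentCalculus.translate R ρ φ)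
      (Sequent.mem_translate_right (by simp))
      (Prv.hyp (Sequent.mem_translate_left (by simp)) (by omega)) hW (by omega)).mono (by omega)
  | bot Γ Δ =>
    have e : (bot (T := T) Γ Δ).size = (Sequent.mk (Γ ++ [.falsum]) Δ).size := by
      simp [size, sequents]
    rw [e] at hd ⊢
    have h₁ := hseq hd ρ
    have h₂ := hmem hd ρ .falsum (by simp)
    have h₃ := hpos ⟨Γ ++ [.falsum], Δ⟩
    exact (Prv.bot (Sequent.mem_translate_left (φ := .falsum) (by simp)) (by omega)).mono (by omega)
  | ax Γ φ h =>
    have e : (ax Γ φ h).size = (Sequent.mk Γ [φ.val]).size := by simp [size, sequents]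
    rw [e] at hd ⊢
    have h₁ := hseq hd ρ
    have h₂ := hmem hd ρ φ.val (by simp)
    have h₃ := hpos ⟨Γ, [φ.val]⟩
    -- The arrow counts as a symbol, which frees 20 units beyond the cost of translating the axiom.
    have h₄ : φ.val.size + 1 ≤ (Sequent.mk Γ [φ.val]).size := by simp [Sequent.size]
    have h₅ := hmul hd (b := φ.val.size) (by omega)
    have h₆ := φ.val.size_pos
    have h₇ : SequentCalculus.translate R ρ φ.val = kuroda R φ.val := by
      unfold SequentCalculus.translate
      rw [subst_eq_self φ.property]
    refine (Prv.contradiction (W := 30 * Q) (n := 1 + 20 * φ.val.size)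
      (X := SequentCalculus.translate R ρ φ.val) (Sequent.mem_translate_right (by simp)) ?_ hW
      (by omega)).mono (by omega)
    rw [h₇]
    exact Prv.kuroda_of_isGeometricImplication (W := 30 * Q) (hT _ h) hW (by nlinarith)
      (Prv.ax h (by nlinarith))
  | weakLeft φ d ih =>
    exact hstr rfl (ih ρ) hd
      (Sequent.translate_mono (by intro; simp; tauto) (by intro; simp))
  | weakRight φ d ih =>
    exact hstr rfl (ih ρ) hd
      (Sequent.translate_mono (by intro; simp) (by intro; simp; tauto))
  | contrLeft d ih =>
    exact hstr rfl (ih ρ) hd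
      (Sequent.translate_mono (by intro; simp) (by intro; simp))
  | contrRight d ih =>
    exact hstr rfl (ih ρ) hd
      (Sequent.translate_mono (by intro; simp) (by intro; simp))
  | exchLeft d ih =>
    exact hstr rfl (ih ρ) hd
      (Sequent.translate_mono (by intro; simp; tauto) (by intro; simp))
  | exchRight d ih =>
    exact hstr rfl (ih ρ) hd
      (Sequent.translate_mono (by intro; simp) (by intro; simp; tauto))
  | @andLeft₁ Γ Δ φ ψ d ih =>
    have e := size_eq_of_one (d := d) (e := andLeft₁ ψ d) rfl
    have hs := hmul hd (Nat.le.intro e.symm)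
    have hd := hmul hd (show d.size ≤ _ by omega)
    have h₀ := hpos ⟨.and φ ψ :: Γ, Δ⟩
    have h₁ := hseq hs ρ
    have h₂ := hmem (hmul hd d.sequent_size_le) ρ φ (by simp)
    have h₃ := hmem hs ρ (.and φ ψ) (by simp)
    simp only [SequentCalculus.translate, Formula.subst, kuroda, Formula.size] at h₃
    have h := hprem d (ih ρ hd) hd hs (X := (SequentCalculus.translate R ρ φ)) (by omega)
      (Sequent.translate_subset_left (by intro; simp; tauto) (by intro; simp))
    rw [e]
    exact (Prv.andE₁ (B := SequentCalculus.translate R ρ ψ)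
      (Sequent.mem_translate_left (φ := .and φ ψ) (by simp)) h
        (by simp [SequentCalculus.translate] at *; omega)).mono (by omega)
  | @andLeft₂ Γ Δ φ ψ d ih =>
    have e := size_eq_of_one (d := d) (e := andLeft₂ φ d) rfl
    have hs := hmul hd (Nat.le.intro e.symm)
    have hd := hmul hd (show d.size ≤ _ by omega)
    have h₀ := hpos ⟨.and φ ψ :: Γ, Δ⟩
    have h₁ := hseq hs ρ
    have h₂ := hmem (hmul hd d.sequent_size_le) ρ ψ (by simp)
    have h₃ := hmem hs ρ (.and φ ψ) (by simp)
    simp only [SequentCalculus.translate, Formula.subst, kuroda, Formula.size] at h₃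
    have h := hprem d (ih ρ hd) hd hs (X := (SequentCalculus.translate R ρ ψ)) (by omega)
      (Sequent.translate_subset_left (by intro; simp; tauto) (by intro; simp))
    rw [e]
    exact (Prv.andE₂ (A := SequentCalculus.translate R ρ φ)
      (Sequent.mem_translate_left (φ := .and φ ψ) (by simp)) h
        (by simp [SequentCalculus.translate] at *; omega)).mono (by omega)
  | @orRight₁ Γ Δ φ ψ d ih =>
    have e := size_eq_of_one (d := d) (e := orRight₁ ψ d) rfl
    have hs := hmul hd (Nat.le.intro e.symm)
    have hd := hmul hd (show d.size ≤ _ by omega)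
    have h₀ := hpos ⟨Γ, Δ ++ [.or φ ψ]⟩
    have h₁ := hseq hs ρ
    have h₂ := hmem (hmul hd d.sequent_size_le) ρ φ (by simp)
    have h₃ := hmem hs ρ (.or φ ψ) (by simp)
    simp only [SequentCalculus.translate, Formula.subst, kuroda, Formula.size] at h₃
    have h := hprem d (ih ρ hd) hd hs (X := neg R (SequentCalculus.translate R ρ φ))
      (by simp [neg, Formula.size]; omega)
      (Sequent.translate_subset_right (by intro; simp) (by intro; simp; tauto))
    rw [e]
    exact (Prv.neg_or₁ (W := 30 * Q) (B := SequentCalculus.translate R ρ ψ)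
      (Sequent.mem_translate_right (φ := .or φ ψ) (by simp)) h hW
        (by simp [SequentCalculus.translate] at *; omega)).mono (by omega)
  | @orRight₂ Γ Δ φ ψ d ih =>
    have e := size_eq_of_one (d := d) (e := orRight₂ φ d) rfl
    have hs := hmul hd (Nat.le.intro e.symm)
    have hd := hmul hd (show d.size ≤ _ by omega)
    have h₀ := hpos ⟨Γ, Δ ++ [.or φ ψ]⟩
    have h₁ := hseq hs ρ
    have h₂ := hmem (hmul hd d.sequent_size_le) ρ ψ (by simp)
    have h₃ := hmem hs ρ (.or φ ψ) (by simp)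
    simp only [SequentCalculus.translate, Formula.subst, kuroda, Formula.size] at h₃
    have h := hprem d (ih ρ hd) hd hs (X := neg R (SequentCalculus.translate R ρ ψ))
      (by simp [neg, Formula.size]; omega)
      (Sequent.translate_subset_right (by intro; simp) (by intro; simp; tauto))
    rw [e]
    exact (Prv.neg_or₂ (W := 30 * Q) (A := SequentCalculus.translate R ρ φ)
      (Sequent.mem_translate_right (φ := .or φ ψ) (by simp)) h hW
        (by simp [SequentCalculus.translate] at *; omega)).mono (by omega)
  | @cut Γ Γ' Δ Δ' φ d₁ d₂ ih₁ ih₂ =>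
    have e := size_eq_of_two (d₁ := d₁) (d₂ := d₂) (e := cut d₁ d₂) rfl
    have hs := hmul hd (show Sequent.size _ ≤ _ by rw [e, add_assoc]; exact Nat.le_add_right _ _)
    have hd₁ := hmul hd (show d₁.size ≤ _ by omega)
    have hd₂ := hmul hd (show d₂.size ≤ _ by omega)
    have h₀ := hpos ⟨Γ ++ Γ', Δ ++ Δ'⟩
    have h₁ := hseq hs ρ
    have h₂ := hmem (hmul hd₁ d₁.sequent_size_le) ρ φ (by simp)
    have h₄ := hmem (hmul hd₂ d₂.sequent_size_le) ρ φ (by simp)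
    have h := hprem d₁ (ih₁ ρ hd₁) hd₁ hs (X := neg R (SequentCalculus.translate R ρ φ))
      (by simp [neg, Formula.size]; omega)
      (Sequent.translate_subset_right (by intro; simp; tauto) (by intro; simp; tauto))
    have h' := hprem d₂ (ih₂ ρ hd₂) hd₂ hs (X := (SequentCalculus.translate R ρ φ)) (by omega)
      (Sequent.translate_subset_left (by intro; simp; tauto) (by intro; simp; tauto))
    rw [e]
    exact (Prv.neg_cut (W := 30 * Q) h h' hW
      (by simp [SequentCalculus.translate] at *; omega)).mono (by omega)
  | @andRight Γ Δ φ ψ d₁ d₂ ih₁ ih₂ =>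
    have e := size_eq_of_two (d₁ := d₁) (d₂ := d₂) (e := andRight d₁ d₂) rfl
    have hs := hmul hd (show Sequent.size _ ≤ _ by rw [e, add_assoc]; exact Nat.le_add_right _ _)
    have hd₁ := hmul hd (show d₁.size ≤ _ by omega)
    have hd₂ := hmul hd (show d₂.size ≤ _ by omega)
    have h₀ := hpos ⟨Γ, Δ ++ [.and φ ψ]⟩
    have h₁ := hseq hs ρ
    have h₂ := hmem (hmul hd₁ d₁.sequent_size_le) ρ φ (by simp)
    have h₄ := hmem (hmul hd₂ d₂.sequent_size_le) ρ ψ (by simp)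
    have h := hprem d₁ (ih₁ ρ hd₁) hd₁ hs (X := neg R (SequentCalculus.translate R ρ φ))
      (by simp [neg, Formula.size]; omega)
      (Sequent.translate_subset_right (by intro; simp) (by intro; simp; tauto))
    have h' := hprem d₂ (ih₂ ρ hd₂) hd₂ hs (X := neg R (SequentCalculus.translate R ρ ψ))
      (by simp [neg, Formula.size]; omega)
      (Sequent.translate_subset_right (by intro; simp) (by intro; simp; tauto))
    rw [e]
    exact (Prv.neg_and (W := 30 * Q) (Sequent.mem_translate_right (φ := .and φ ψ) (by simp)) h h' hW
      (by simp [SequentCalculus.translate] at *; omega)).mono (by omega)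
  | @orLeft Γ Δ φ ψ d₁ d₂ ih₁ ih₂ =>
    have e := size_eq_of_two (d₁ := d₁) (d₂ := d₂) (e := orLeft d₁ d₂) rfl
    have hs := hmul hd (show Sequent.size _ ≤ _ by rw [e, add_assoc]; exact Nat.le_add_right _ _)
    have hd₁ := hmul hd (show d₁.size ≤ _ by omega)
    have hd₂ := hmul hd (show d₂.size ≤ _ by omega)
    have h₀ := hpos ⟨.or φ ψ :: Γ, Δ⟩
    have h₁ := hseq hs ρ
    have h₂ := hmem (hmul hd₁ d₁.sequent_size_le) ρ φ (by simp)
    have h₄ := hmem (hmul hd₂ d₂.sequent_size_le) ρ ψ (by simp)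
    have h := hprem d₁ (ih₁ ρ hd₁) hd₁ hs (X := (SequentCalculus.translate R ρ φ)) (by omega)
      (Sequent.translate_subset_left (by intro; simp; tauto) (by intro; simp))
    have h' := hprem d₂ (ih₂ ρ hd₂) hd₂ hs (X := (SequentCalculus.translate R ρ ψ)) (by omega)
      (Sequent.translate_subset_left (by intro; simp; tauto) (by intro; simp))
    rw [e]
    exact (Prv.orE (Sequent.mem_translate_left (φ := .or φ ψ) (by simp)) h h'
      (by simp [SequentCalculus.translate] at *; omega)).mono (by omega)
  | @impLeft Γ Γ' Δ Δ' φ ψ d₁ d₂ ih₁ ih₂ =>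
    have e := size_eq_of_two (d₁ := d₁) (d₂ := d₂) (e := impLeft d₁ d₂) rfl
    have hs := hmul hd (show Sequent.size _ ≤ _ by rw [e, add_assoc]; exact Nat.le_add_right _ _)
    have hd₁ := hmul hd (show d₁.size ≤ _ by omega)
    have hd₂ := hmul hd (show d₂.size ≤ _ by omega)
    have h₀ := hpos ⟨.imp φ ψ :: (Γ ++ Γ'), Δ ++ Δ'⟩
    have h₁ := hseq hs ρ
    have h₂ := hmem (hmul hd₁ d₁.sequent_size_le) ρ φ (by simp)
    have h₄ := hmem (hmul hd₂ d₂.sequent_size_le) ρ ψ (by simp)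
    have h := hprem d₁ (ih₁ ρ hd₁) hd₁ hs (X := neg R (SequentCalculus.translate R ρ φ))
      (by simp [neg, Formula.size]; omega)
      (Sequent.translate_subset_right (by intro; simp; tauto) (by intro; simp; tauto))
    have h' := hprem d₂ (ih₂ ρ hd₂) hd₂ hs (X := (SequentCalculus.translate R ρ ψ)) (by omega)
      (Sequent.translate_subset_left (by intro; simp; tauto) (by intro; simp; tauto))
    rw [e]
    exact (Prv.imp_left (W := 30 * Q) (Sequent.mem_translate_left (φ := .imp φ ψ) (by simp)) h h' hW
      (by simp [SequentCalculus.translate] at *; omega)).mono (by omega)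
  | @impRight Γ Δ φ ψ d ih =>
    have e := size_eq_of_one (d := d) (e := impRight d) rfl
    have hs := hmul hd (Nat.le.intro e.symm)
    have hd := hmul hd (show d.size ≤ _ by omega)
    have h₀ := hpos ⟨Γ, Δ ++ [.imp φ ψ]⟩
    have h₁ := hseq hs ρ
    have h₂ := hmem (hmul hd d.sequent_size_le) ρ φ (by simp)
    have h₄ := hmem (hmul hd d.sequent_size_le) ρ ψ (by simp)
    rw [e]
    refine (Prv.neg_imp (W := 30 * Q) (A := SequentCalculus.translate R ρ φ)
      (B := SequentCalculus.translate R ρ ψ) (n := 20 * d.size + 1)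
      (Sequent.mem_translate_right (φ := .imp φ ψ) (by simp)) ?_ hW (by omega)).mono (by omega)
    refine (ih ρ hd).of_translate
      (Sequent.translate_subset [φ] [ψ] (by intro; simp) (by intro; simp; tauto)) hK
      (hmul hd d.sequent_size_le) (by simp [neg, Formula.size]; omega)
  | @allLeft Γ Δ φ t d ih =>
    have e := size_eq_of_one (d := d) (e := allLeft t d) rfl
    have hs := hmul hd (Nat.le.intro e.symm)
    have hd := hmul hd (show d.size ≤ _ by omega)
    have h₀ := hpos ⟨.all φ :: Γ, Δ⟩
    have h₁ := hseq hs ρ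
    -- The instance may be much larger than `φ`, but it occurs in the premise, whose size is part of
    -- that of the derivation.
    have h₂ := hmem (hmul hd d.sequent_size_le) ρ (φ.inst t) (by simp)
    have h₃ := hmem hs ρ (.all φ) (by simp)
    simp only [SequentCalculus.translate, Formula.subst, kuroda, neg, Formula.size] at h₃
    have h := hprem d (ih ρ hd) hd hs (X := SequentCalculus.translate R ρ (φ.inst t)) (by omega)
      (Sequent.translate_subset_left (by intro; simp; tauto) (by intro; simp))
    rw [translate_inst] at h h₂
    rw [e]
    exact (Prv.all_left (W := 30 * Q) _ (Sequent.mem_translate_left (φ := .all φ) (by simp)) h hW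
      (by omega)).mono (by omega)
  | @exRight Γ Δ φ t d ih =>
    have e := size_eq_of_one (d := d) (e := exRight t d) rfl
    have hs := hmul hd (Nat.le.intro e.symm)
    have hd := hmul hd (show d.size ≤ _ by omega)
    have h₀ := hpos ⟨Γ, Δ ++ [.ex φ]⟩
    have h₁ := hseq hs ρ
    have h₂ := hmem (hmul hd d.sequent_size_le) ρ (φ.inst t) (by simp)
    have h₃ := hmem hs ρ (.ex φ) (by simp)
    simp only [SequentCalculus.translate, Formula.subst, kuroda, Formula.size] at h₃
    have h := hprem d (ih ρ hd) hd hs (X := neg R (SequentCalculus.translate R ρ (φ.inst t)))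
      (by simp [neg, Formula.size]; omega)
      (Sequent.translate_subset_right (by intro; simp) (by intro; simp; tauto))
    rw [translate_inst] at h h₂
    rw [e]
    exact (Prv.neg_ex (W := 30 * Q) _ (Sequent.mem_translate_right (φ := .ex φ) (by simp)) h hW
      (by omega)).mono (by omega)
  | @allRight Γ Δ φ a ha d ih =>
    have e := size_eq_of_one (d := d) (e := allRight a ha d) rfl
    have hs := hmul hd (Nat.le.intro e.symm)
    have hd := hmul hd (show d.size ≤ _ by omega)
    have h₀ := hpos ⟨Γ, Δ ++ [.all φ]⟩
    have h₁ := hseq hs ρ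
    have h₃ := hmem hs ρ (.all φ) (by simp)
    simp only [SequentCalculus.translate, Formula.subst, kuroda, neg, Formula.size] at h₃
    have ha' : a + 1 ∉ φ.freeVars := fun h => ha ⟨.all φ, by simp, h⟩
    rw [e]
    refine (Prv.neg_all (W := 30 * Q) (n := 20 * d.size + 1)
      (Sequent.mem_translate_right (φ := .all φ) (by simp)) (fun b => ?_) hW (by omega)).mono
      (by omega)
    -- Sending the eigenvariable `a` to an arbitrary `b` leaves the translated conclusion unchanged,
    -- as `a` is not free there.
    have h₂ := hmem (hmul hd d.sequent_size_le) (Function.update ρ a b) (φ.inst (.var a)) (by simp)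
    have h := hprem d (ih _ hd) hd hs (ρ := Function.update ρ a b)
      (X := neg R (SequentCalculus.translate R (Function.update ρ a b) (φ.inst (.var a))))
      (by simp [neg, Formula.size]; omega)
      (Sequent.translate_subset_right (by intro; simp) (by intro; simp; tauto))
    rwa [translate_inst_update ha', Sequent.translate_update ha] at h
  | @exLeft Γ Δ φ a ha d ih =>
    have e := size_eq_of_one (d := d) (e := exLeft a ha d) rfl
    have hs := hmul hd (Nat.le.intro e.symm)
    have hd := hmul hd (show d.size ≤ _ by omega)
    have h₀ := hpos ⟨.ex φ :: Γ, Δ⟩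
    have h₁ := hseq hs ρ
    have h₃ := hmem hs ρ (.ex φ) (by simp)
    simp only [SequentCalculus.translate, Formula.subst, kuroda, Formula.size] at h₃
    have ha' : a + 1 ∉ φ.freeVars := fun h => ha ⟨.ex φ, by simp, h⟩
    rw [e]
    refine (Prv.exE (n := 20 * d.size + 1)
      (Sequent.mem_translate_left (φ := .ex φ) (by simp)) (fun b => ?_) (by omega)).mono (by omega)
    have h₂ := hmem (hmul hd d.sequent_size_le) (Function.update ρ a b) (φ.inst (.var a)) (by simp)
    have h := hprem d (ih _ hd) hd hs (ρ := Function.update ρ a b)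
      (X := SequentCalculus.translate R (Function.update ρ a b) (φ.inst (.var a)))
      (by omega)
      (Sequent.translate_subset_left (by intro; simp; tauto) (by intro; simp))
    rwa [translate_inst_update ha', Sequent.translate_update ha] at h

/-! ### The polynomial bound. -/

/-- Every classical derivation of a geometric implication from a geometric theory can be made
intuitionistic, with a polynomial increase of the size. -/
theorem Derivation.exists_isIntuitionistic {T : Theory L} (hT : T.IsGeometric) {φ : Formula L}
    (hφ : φ.IsGeometricImplication) (d : Derivation T ⟨[], [φ]⟩) :
    ∃ d' : Derivation T ⟨[], [φ]⟩, d'.IsIntuitionistic ∧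
      d'.size ≤ 2000 * 4200 ^ 3 * d.size ^ 7 := by
  obtain ⟨Γ, R, hΓ, H⟩ := hφ.exists_sequent
  have hφd : φ.size + 1 ≤ d.size := by
    have := d.sequent_size_le
    simp [Sequent.size] at this
    omega
  set S := d.size with hS
  -- From `R.size ≤ φ.size < S`. This fixes `Q = 7 * S ^ 2` and `K = 600 * Q = 4200 * S ^ 2`.
  have hR : (3 * R.size + 4) * S ≤ 7 * S ^ 2 := by nlinarith
  have h₁ := d.prv_translate hT R (K := 4200 * S ^ 2) (Q := 7 * S ^ 2) (by omega) id hR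
  rw [← hS] at h₁
  have e : Sequent.translate R id ⟨[], [φ]⟩ = [neg R (kuroda R φ)] := by
    simp only [Sequent.translate, SequentCalculus.translate, id, subst_var, List.map_nil,
      List.map_cons, List.nil_append]
  rw [e] at h₁
  have hW : (20 * R.size + 40) * φ.size ≤ 60 * S ^ 2 := by nlinarith
  obtain ⟨h₂, h₃⟩ := H T (4200 * S ^ 2) (60 * S ^ 2) (by omega) hW
  have hs := size_kuroda_le R φ
  have hs' : (2 * R.size + 3) * φ.size ≤ 5 * S ^ 2 := by nlinarith
  have hS' : S ≤ S ^ 2 := by nlinarith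
  -- Both the translation of `φ` (by `h₂`) and its negation (by `h₁`) lead to `R`.
  obtain ⟨d', hd₁, hd₂, hd₃⟩ := h₃ _ (Prv.neg_cut (W := 60 * S ^ 2)
    (h₁.weak (Γ' := neg R (kuroda R φ) :: Γ) (by simp) (by simp [neg, Formula.size]; omega)) h₂
    (by omega) (by omega))
  refine ⟨d', hd₁, ?_⟩
  have hsum : d'.size ≤ d'.sequents.length * (4200 * S ^ 2) := by
    have := List.sum_le_card_nsmul (d'.sequents.map Sequent.size) (4200 * S ^ 2)
      (by simpa using hd₃)
    simpa [size] using this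
  have hunits : 20 * S + 1 + 20 * φ.size + 2 + φ.size ≤ 100 * S := by omega
  -- At most `100 * S` units of `20 * K ^ 2` sequents, each of size at most `K`: degree `1 + 4 + 2 =
  -- 7`.
  calc d'.size ≤ d'.sequents.length * (4200 * S ^ 2) := hsum
    _ ≤ (100 * S) * (20 * (4200 * S ^ 2) ^ 2) * (4200 * S ^ 2) :=
      by gcongr; exact hd₂.trans (by gcongr)
    _ = 2000 * 4200 ^ 3 * S ^ 7 := by ring

end SequentCalculus

theorem theorem3p9 :
    (∀ (L : FirstOrder.Language.{u, v}) (T : SequentCalculus.Theory L)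
        (φ : SequentCalculus.Formula L),
        T.IsGeometric → φ.IsGeometricImplication →
        SequentCalculus.ProvesClassically T φ → SequentCalculus.ProvesIntuitionistically T φ) ∧
    ∃ p : Polynomial ℕ,
      ∀ (L : FirstOrder.Language.{u, v}) (T : SequentCalculus.Theory L)
        (φ : SequentCalculus.Formula L),
        T.IsGeometric → φ.IsGeometricImplication →
        ∀ d : SequentCalculus.Derivation T ⟨[], [φ]⟩,
          ∃ d' : SequentCalculus.Derivation T ⟨[], [φ]⟩,
            d'.IsIntuitionistic ∧ d'.size ≤ p.eval d.size := by
  refine ⟨fun L T φ hT hφ ⟨d⟩ => ?_,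
    .C (2000 * 4200 ^ 3) * .X ^ 7, fun L T φ hT hφ d => ?_⟩
  · obtain ⟨d', hd', -⟩ := d.exists_isIntuitionistic hT hφ
    exact ⟨d', hd'⟩
  · simpa only [Polynomial.eval_mul, Polynomial.eval_C, Polynomial.eval_pow, Polynomial.eval_X]
      using d.exists_isIntuitionistic hT hφ
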